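/- Let $k\ge 1$, let $N=\mathbb{C}^k$ with coordinates $\sigma_1,\dots,\sigma_k$, let $\partial_h=\partial/\partial\sigma_h$, let $\mathcal{O}_N$ be the sheaf of holomorphic functions and $D_N$ the sheaf of holomorphic differential operators on $N$. Put $E=\sum_{h=1}^k\sigma_h\partial_h$. For $\mu\in\mathbb{C}$ let $\mathcal{I}_\mu\subset D_N$ be the left ideal generated by $$A_{i,j}=\partial_i\partial_j-\partial_{i+1}\partial_{j-1}\quad(1\le i\le k-1,\ 2\le j\le k),\qquad T^m_\mu=\partial_1\partial_{m-1}+\partial_m(E+\mu)\quad(2\le m\le k),$$ let $\mathcal{M}_\mu=D_N/\mathcal{I}_\mu$, and let $L_\mu\subset D_N$ be the left ideal generated by the $A_{i,j}$, by $\partial_1\partial_m$ for $1\le m\le k-1$, and by $E+\mu$. All assertions below about sheaves on $N$ are understood on the stalks at every point $p\in N$. Assume $\mu\neq 0$. 1. Right multiplication $P\mapsto P(E+\mu)$ induces a well-defined injective left $D_N$-linear map $\mathcal{M}_{\mu+1}\to\mathcal{M}_\mu$. The kernel of $D_N\to Q_\mu:=\mathcal{M}_\mu/\mathcal{M}_{\mu+1}(E+\mu)$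 is $L_\mu$, so that $Q_\mu\simeq D_N/L_\mu$. 2. Let $M$ be the lower triangular $k\times k$ matrix with entries $M_{ij}=\sigma_{k-(i-j)}$ for $i\ge j$ and $M_{ij}=0$ for $i<j$; it is invertible over $\mathcal{O}_N[\sigma_k^{-1}]$. The free module $V=\mathcal{O}_N[\sigma_k^{-1}]^k$, with standard basis $e_1,\dots,e_k$, carries a left $D_N$-module structure extending its $\mathcal{O}_N$-module structure and satisfying $$\partial_k\begin{pmatrix}e_1\\ \vdots\\ e_k\end{pmatrix}=-(\mu+1)M^{-1}\begin{pmatrix}e_1\\ \vdots\\ e_k\end{pmatrix},\qquad \partial_p e_q=\partial_k e_h\ \text{ if } p+q=k+h,\ 1\le h\le k,\qquad \partial_p e_q=0\ \text{ if } p+q\le k$$ ($1\le p,q\le k$), and there is a $D_N$-linear map $\varphi:Q_\mu\to V$, sending the class of $\partial_h$ to $e_h$ for $1\le h\le k$, which exhibits $V$ as the localization of $Q_\mu$ in $\sigma_k$: $\sigma_k$ acts bijectively on $V$, every element of $V$ is sent into the image of $\varphi$ by some power of $\sigma_k$, and every element of $\ker\varphi$ is annihilated by some power of $\sigma_k$.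 3. If moreover $\mu\notin-\mathbb{N}=\{0,-1,-2,\dots\}$, then $\varphi$ is an isomorphism, i.e. $Q_\mu$ itself is the free $\mathcal{O}_N[\sigma_k^{-1}]$-module with basis the classes of $\partial_1,\dots,\partial_k$ and with the above action of $D_N$. In particular, for all $n\ge1$ and $1\le h\le k$ there is a unique $\xi\in Q_\mu$ with $\sigma_k^n\xi=[\partial_h]$. -/

import Mathlib

open Filter Topology

noncomputable section

namespace MuTrace

/-- Germs of complex valued functions form a `ℂ`-algebra (with pointwise operations). -/
instance germAlgebra {X : Type*} (l : Filter X) : Algebra ℂ (Germ l ℂ) :=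
  Algebra.ofModule
    (fun r x y => by
      induction x using Germ.inductionOn with | _ f =>
      induction y using Germ.inductionOn with | _ g =>
      exact congrArg Germ.ofFun (smul_mul_assoc r f g))
    (fun r x y => by
      induction x using Germ.inductionOn with | _ f =>
      induction y using Germ.inductionOn with | _ g =>
      exact congrArg Germ.ofFun (mul_smul_comm r f g))

/-- The ring `𝒪_{N,p}` of germs at `p` of holomorphic functions on `N = ℂ^k`. -/
def holGerms (k : ℕ) (p : Fin k → ℂ) : Subalgebra ℂ (Germ (𝓝 p) ℂ) where
  carrier := {g | ∃ f : (Fin k → ℂ) → ℂ, AnalyticAt ℂ f p ∧ (f : Germ (𝓝 p) ℂ) = g}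
  mul_mem' := by
    rintro _ _ ⟨f, hf, rfl⟩ ⟨g, hg, rfl⟩
    exact ⟨f * g, hf.mul hg, rfl⟩
  add_mem' := by
    rintro _ _ ⟨f, hf, rfl⟩ ⟨g, hg, rfl⟩
    exact ⟨f + g, hf.add hg, rfl⟩
  algebraMap_mem' := fun c => ⟨c • (1 : (Fin k → ℂ) → ℂ), analyticAt_const.smul analyticAt_const, by
    rw [Algebra.algebraMap_eq_smul_one]; rfl⟩

/-- The ring `𝒪_{N,p}`, as a type. -/
def Hol (k : ℕ) (p : Fin k → ℂ) : Type := holGerms k p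

instance (k : ℕ) (p : Fin k → ℂ) : CommRing (Hol k p) :=
  inferInstanceAs (CommRing (holGerms k p))

instance (k : ℕ) (p : Fin k → ℂ) : Algebra ℂ (Hol k p) :=
  inferInstanceAs (Algebra ℂ (holGerms k p))

/-- The germ at `p` of a function holomorphic near `p`. -/
def germOf {k : ℕ} {p : Fin k → ℂ} (f : (Fin k → ℂ) → ℂ) (hf : AnalyticAt ℂ f p) : Hol k p :=
  ⟨(f : Germ (𝓝 p) ℂ), f, hf, rfl⟩

/-- The germ of `∂f/∂x_i`, as a function of the germ of `f`. -/
def partialGerm {k : ℕ} {p : Fin k → ℂ} (i : Fin k) : Germ (𝓝 p) ℂ → Germ (𝓝 p) ℂ :=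
  Germ.map' (fun f x => fderiv ℂ f x (Pi.single i 1))
    (fun _ _ h => (h.fderiv (𝕜 := ℂ)).mono fun _ hx => by simp only [hx])

/-- The partial derivative with respect to the `i`-th coordinate (counted from `0`) on
`𝒪_{N,p}`. -/
def partialDeriv {k : ℕ} {p : Fin k → ℂ} (i : Fin k) : Hol k p →ₗ[ℂ] Hol k p where
  toFun g := ⟨partialGerm i g.1, by
    obtain ⟨_, f, hf, rfl⟩ := g
    have h := ((ContinuousLinearMap.apply ℂ ℂ (Pi.single i (1 : ℂ) : Fin k → ℂ)).analyticAt
      (fderiv ℂ f p)).comp hf.fderiv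
    exact ⟨fun x => fderiv ℂ f x (Pi.single i 1), h, rfl⟩⟩
  map_add' := by
    rintro ⟨_, f, hf, rfl⟩ ⟨_, g, hg, rfl⟩
    refine Subtype.ext (Germ.coe_eq.2 ?_)
    filter_upwards [hf.eventually_analyticAt, hg.eventually_analyticAt] with x hx hy
    show fderiv ℂ (f + g) x _ = fderiv ℂ f x _ + fderiv ℂ g x _
    rw [fderiv_add hx.differentiableAt hy.differentiableAt]
    rfl
  map_smul' := by
    rintro c ⟨_, f, hf, rfl⟩
    refine Subtype.ext (Germ.coe_eq.2 ?_)
    filter_upwards [hf.eventually_analyticAt] with x hx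
    show fderiv ℂ (c • f) x _ = c • fderiv ℂ f x _
    rw [fderiv_const_smul hx.differentiableAt]
    rfl

/-- The ring `D_{N,p}` of germs at `p` of holomorphic differential operators: the ring of
operators on `𝒪_{N,p}` generated by the multiplications and the partial derivatives. -/
def diffOps (k : ℕ) (p : Fin k → ℂ) : Subalgebra ℂ (Module.End ℂ (Hol k p)) :=
  Algebra.adjoin ℂ
    (Set.range (fun f : Hol k p => LinearMap.mulLeft ℂ f) ∪
      Set.range (fun i : Fin k => (partialDeriv i : Hol k p →ₗ[ℂ] Hol k p)))

/-- The ring `D_{N,p}`, as a type. -/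
def DiffOp (k : ℕ) (p : Fin k → ℂ) : Type := diffOps k p

instance (k : ℕ) (p : Fin k → ℂ) : Ring (DiffOp k p) :=
  inferInstanceAs (Ring (diffOps k p))

instance (k : ℕ) (p : Fin k → ℂ) : Algebra ℂ (DiffOp k p) :=
  inferInstanceAs (Algebra ℂ (diffOps k p))

variable (k : ℕ) (p : Fin k → ℂ)

/-- The coordinate function `σ_h`, `1 ≤ h ≤ k`, as a germ at `p` (and `0` for other `h`). -/
def sig (h : ℕ) : Hol k p :=
  if hh : 1 ≤ h ∧ h ≤ k then
    germOf (fun x => x ⟨h - 1, by omega⟩)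
      ((ContinuousLinearMap.proj (R := ℂ) (φ := fun _ : Fin k => ℂ)
        (⟨h - 1, by omega⟩ : Fin k)).analyticAt p)
  else 0

variable {k p} in
/-- A germ of holomorphic function as a differential operator of order `0`. -/
def mulOp (f : Hol k p) : DiffOp k p :=
  ⟨LinearMap.mulLeft ℂ f, Algebra.subset_adjoin (Or.inl ⟨f, rfl⟩)⟩

variable {k p} in
/-- The partial derivative with respect to the `i`-th coordinate (counted from `0`) as a
differential operator. -/
def pdOp (i : Fin k) : DiffOp k p :=
  ⟨partialDeriv i, Algebra.subset_adjoin (Or.inr ⟨i, rfl⟩)⟩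

/-- The operator `∂_h = ∂/∂σ_h`, `1 ≤ h ≤ k` (and `0` for other `h`). -/
def pd (h : ℕ) : DiffOp k p :=
  if hh : 1 ≤ h ∧ h ≤ k then pdOp ⟨h - 1, by omega⟩ else 0

/-- The operator `E + μ`, where `E = ∑_{h=1}^k σ_h ∂_h`. -/
def Eop (μ : ℂ) : DiffOp k p :=
  ∑ h ∈ Finset.Icc 1 k, mulOp (sig k p h) * pd k p h + algebraMap ℂ (DiffOp k p) μ

/-- The operators `A_{i,j} = ∂_i ∂_j - ∂_{i+1} ∂_{j-1}`, `1 ≤ i ≤ k-1`, `2 ≤ j ≤ k`. -/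
def opsA : Set (DiffOp k p) :=
  {P | ∃ i j : ℕ, 1 ≤ i ∧ i + 1 ≤ k ∧ 2 ≤ j ∧ j ≤ k ∧
    P = pd k p i * pd k p j - pd k p (i + 1) * pd k p (j - 1)}

/-- The operators `T^m_μ = ∂_1 ∂_{m-1} + ∂_m (E + μ)`, `2 ≤ m ≤ k`. -/
def opsT (μ : ℂ) : Set (DiffOp k p) :=
  {P | ∃ m : ℕ, 2 ≤ m ∧ m ≤ k ∧
    P = pd k p 1 * pd k p (m - 1) + pd k p m * Eop k p μ}

/-- The stalk at `p` of the left ideal `ℐ_μ`. -/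
def idealI (μ : ℂ) : Submodule (DiffOp k p) (DiffOp k p) :=
  Submodule.span (DiffOp k p) (opsA k p ∪ opsT k p μ)

/-- The stalk at `p` of the left ideal `L_μ` generated by the `A_{i,j}`, the `∂_1 ∂_m` for
`1 ≤ m ≤ k-1`, and `E + μ`. -/
def idealL (μ : ℂ) : Submodule (DiffOp k p) (DiffOp k p) :=
  Submodule.span (DiffOp k p)
    (opsA k p ∪ {P | ∃ m : ℕ, 1 ≤ m ∧ m + 1 ≤ k ∧ P = pd k p 1 * pd k p m} ∪ {Eop k p μ})

/-- The stalk at `p` of the left `D_N`-module `ℳ_μ = D_N / ℐ_μ`. -/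
abbrev ModM (μ : ℂ) : Type := DiffOp k p ⧸ idealI k p μ

variable {k p} in
/-- The class in `ℳ_μ` of a differential operator. -/
def cls (μ : ℂ) (P : DiffOp k p) : ModM k p μ := (idealI k p μ).mkQ P

/-- The ring `𝒪_{N,p}[σ_k⁻¹]`. -/
abbrev HolLoc : Type := Localization.Away (sig k p k)

/-- The free module `𝒪_{N,p}[σ_k⁻¹]^k`. -/
def FreeLoc : Type := Fin k → HolLoc k p

instance : AddCommGroup (FreeLoc k p) := inferInstanceAs (AddCommGroup (Fin k → HolLoc k p))

instance : Module (HolLoc k p) (FreeLoc k p) :=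
  inferInstanceAs (Module (HolLoc k p) (Fin k → HolLoc k p))

/-- The `h`-th vector, `1 ≤ h ≤ k`, of the standard basis of `𝒪_{N,p}[σ_k⁻¹]^k`. -/
def stdVec (h : ℕ) : FreeLoc k p := fun j => if (j : ℕ) + 1 = h then 1 else 0

/-- The lower triangular `k × k` matrix with entry `σ_{k-(i-j)}` in row `i` and column `j ≤ i`. -/
def matM : Matrix (Fin k) (Fin k) (HolLoc k p) :=
  Matrix.of fun i j =>
    if j ≤ i then algebraMap (Hol k p) (HolLoc k p) (sig k p (k - ((i : ℕ) - (j : ℕ)))) else 0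

/-- A `D_{N,p}`-linear map `φ : Q → V` exhibits `V` as the localization of `Q` in `σ_k`. -/
def IsSigmaLocalization {Q V : Type*} [AddCommGroup Q] [Module (DiffOp k p) Q]
    [AddCommGroup V] [Module (DiffOp k p) V] (φ : Q →ₗ[DiffOp k p] V) : Prop :=
  Function.Bijective (fun v : V => mulOp (sig k p k) • v) ∧
  (∀ v : V, ∃ (n : ℕ) (x : Q), mulOp (sig k p k) ^ n • v = φ x) ∧
  (∀ x : Q, φ x = 0 → ∃ n : ℕ, mulOp (sig k p k) ^ n • x = 0)

/-- A left `D_{N,p}`-module structure on `𝒪_{N,p}[σ_k⁻¹]^k` is the one of the explicit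
meromorphic connection: functions act by multiplication, and
`∂_k (e_1, …, e_k)ᵗ = -(μ+1) M⁻¹ (e_1, …, e_k)ᵗ`, `∂_a e_q = ∂_k e_h` if `a + q = k + h` with
`1 ≤ h ≤ k`, `∂_a e_q = 0` if `a + q ≤ k`. -/
def IsConnectionAction (μ : ℂ) (inst : Module (DiffOp k p) (FreeLoc k p)) : Prop :=
  (∀ (f : Hol k p) (v : FreeLoc k p),
    mulOp f • v = algebraMap (Hol k p) (HolLoc k p) f • v) ∧
  (∀ i : Fin k, pd k p k • stdVec k p ((i : ℕ) + 1) =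
    -(algebraMap (Hol k p) (HolLoc k p) (algebraMap ℂ (Hol k p) (μ + 1))) •
      ∑ j : Fin k, (matM k p)⁻¹ i j • stdVec k p ((j : ℕ) + 1)) ∧
  (∀ a q h : ℕ, 1 ≤ a → a ≤ k → 1 ≤ q → q ≤ k → 1 ≤ h → h ≤ k → a + q = k + h →
    pd k p a • stdVec k p q = pd k p k • stdVec k p h) ∧
  (∀ a q : ℕ, 1 ≤ a → 1 ≤ q → a + q ≤ k → pd k p a • stdVec k p q = 0)

end MuTrace

end

noncomputable section

namespace MuTrace

/-! ### Germs of holomorphic functions, their partial derivatives, and generators of `DiffOp` -/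

variable {k : ℕ} {p : Fin k → ℂ}

/-! Operators have a unique normal form with coefficients on the left (`opEquiv`), so a `D`-module
is the same thing as a module over functions with commuting operators satisfying the Leibniz rule
(`extHom`). Two modules are built this way.

The symbol module `𝒪[t][s]`, where `∂_{i+1}` acts as its derivation on coefficients plus
multiplication by `s t^i`, is used for injectivity. The kernel of `P ↦ P • 1` is the left ideal of
the `A_{i,j}` (`symb_opsA`, `mem_of_smul_one_eq_zero`). On symbols, right multiplication by `E + μ`
becomes the operator `symEuler μ`, that is `s Q(t) + μ + s ∂/∂s` with `Q = ∑ σ_{i+1} t^i`, and `ℐ_μ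
• 1` is the image under `symRel μ = s + t · symEuler μ` of the symbols whose `s^q`-coefficient has
`t`-degree `< q (k-1)`. If `P (E + μ) ∈ ℐ_μ`, cancelling a factor `s` writes `P • 1` as `symRel
(μ+1) u'`, and the leading coefficient `σ_k` of `Q` bounds the degrees of `u'`
(`mem_idealI_of_mul_Eop_mem`). The cokernel is `D / L_μ` because `T^m_μ ≡ ∂_1 ∂_{m-1}` modulo `E +
μ`.

The second module is the connection on `V`. The matrix `M` is a polynomial in the shift matrix, so
all connection matrices commute and flatness is a symmetry in two indices (`conn_commute`). It
contains a vector `v` killed by `L_μ` with `∂_h v = e_h` (`exists_solution`), whence `φ`.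

To compare, let `u` be any vector killed by `L_μ` and `z_{q,j} = ∂_k^q ∂_{j+1} u`. Homogeneity gives
`σ_k z_{q+1,j} + (μ+q+1) z_{q,j}` as an `𝒪`-combination of the `z_{q+1,j'}` with `j' < j`
(`zvec_triangular`). Read upwards in `q`, this shows that a power of `σ_k` brings each `P u` into
the span of the `z_{0,j}`. Read downwards, when no `μ+q+1` vanishes, it shows that each `P u` lies
in the span of the `z_{q,j}` for one `q` and is divisible by `σ_k`. These facts give the
localization statement and the bijectivity of `φ`. -/

theorem Hol.exists_rep (g : Hol k p) :
    ∃ (f : (Fin k → ℂ) → ℂ) (hf : AnalyticAt ℂ f p), g = germOf f hf := by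
  obtain ⟨_, f, hf, rfl⟩ := g
  exact ⟨f, hf, rfl⟩

theorem germOf_eq_iff {f g : (Fin k → ℂ) → ℂ} (hf : AnalyticAt ℂ f p) (hg : AnalyticAt ℂ g p) :
    germOf f hf = germOf g hg ↔ f =ᶠ[𝓝 p] g :=
  Subtype.ext_iff.trans Germ.coe_eq

theorem germOf_mul {f g : (Fin k → ℂ) → ℂ} (hf : AnalyticAt ℂ f p) (hg : AnalyticAt ℂ g p) :
    germOf f hf * germOf g hg = germOf (f * g) (hf.mul hg) := rfl

theorem germOf_add {f g : (Fin k → ℂ) → ℂ} (hf : AnalyticAt ℂ f p) (hg : AnalyticAt ℂ g p) :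
    germOf f hf + germOf g hg = germOf (f + g) (hf.add hg) := rfl

theorem analyticAt_partial {f : (Fin k → ℂ) → ℂ} {x : Fin k → ℂ} (hf : AnalyticAt ℂ f x)
    (i : Fin k) : AnalyticAt ℂ (fun x => fderiv ℂ f x (Pi.single i 1)) x :=
  ((ContinuousLinearMap.apply ℂ ℂ (Pi.single i (1 : ℂ) : Fin k → ℂ)).analyticAt
      (fderiv ℂ f x)).comp hf.fderiv

theorem partialDeriv_germOf {f : (Fin k → ℂ) → ℂ} (hf : AnalyticAt ℂ f p) (i : Fin k) :
    partialDeriv i (germOf f hf) =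
      germOf (fun x => fderiv ℂ f x (Pi.single i 1)) (analyticAt_partial hf i) := rfl

theorem partialDeriv_mul (i : Fin k) (f g : Hol k p) :
    partialDeriv i (f * g) = f * partialDeriv i g + g * partialDeriv i f := by
  obtain ⟨f, hf, rfl⟩ := f.exists_rep
  obtain ⟨g, hg, rfl⟩ := g.exists_rep
  simp only [germOf_mul, partialDeriv_germOf, germOf_add]
  rw [germOf_eq_iff]
  filter_upwards [hf.eventually_analyticAt, hg.eventually_analyticAt] with x hx hy
  rw [fderiv_mul hx.differentiableAt hy.differentiableAt]
  rfl

theorem partialDeriv_comm (i j : Fin k) (f : Hol k p) :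
    partialDeriv i (partialDeriv j f) = partialDeriv j (partialDeriv i f) := by
  obtain ⟨f, hf, rfl⟩ := f.exists_rep
  simp only [partialDeriv_germOf]
  rw [germOf_eq_iff]
  filter_upwards [hf.eventually_analyticAt] with x hx
  have hd : DifferentiableAt ℂ (fderiv ℂ f) x := hx.fderiv.differentiableAt
  have key : ∀ i j : Fin k, fderiv ℂ (fun x => fderiv ℂ f x (Pi.single j 1)) x (Pi.single i 1) =
      fderiv ℂ (fderiv ℂ f) x (Pi.single i 1) (Pi.single j 1) := by
    intro i j
    rw [fderiv_clm_apply hd (differentiableAt_const _)]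
    simp
  rw [key, key]
  exact (hx.contDiffAt (n := ⊤)).isSymmSndFDerivAt (by simp) _ _

/-- The partial derivative as a derivation of `𝒪_{N,p}`. -/
def pdDer (i : Fin k) : Derivation ℂ (Hol k p) (Hol k p) :=
  Derivation.mk' (partialDeriv i) (partialDeriv_mul i)

@[simp]
theorem pdDer_apply (i : Fin k) (f : Hol k p) : pdDer i f = partialDeriv i f := rfl

/-- The coordinate functions, indexed from `0`. -/
def co (k : ℕ) (p : Fin k → ℂ) (i : Fin k) : Hol k p := sig k p (i + 1)

theorem analyticAt_coord (i : Fin k) (p : Fin k → ℂ) :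
    AnalyticAt ℂ (fun x : Fin k → ℂ => x i) p :=
  (ContinuousLinearMap.proj (R := ℂ) (φ := fun _ : Fin k => ℂ) i).analyticAt p

theorem co_eq (i : Fin k) : co k p i = germOf (fun x => x i) (analyticAt_coord i p) := by
  unfold co sig
  rw [dif_pos ⟨by omega, by omega⟩]
  rfl

theorem germOf_zero : germOf (fun _ => (0 : ℂ)) analyticAt_const = (0 : Hol k p) := rfl

theorem partialDeriv_co (i j : Fin k) :
    partialDeriv i (co k p j) = if i = j then 1 else 0 := by
  have h : ∀ x : Fin k → ℂ, fderiv ℂ (fun x : Fin k → ℂ => x j) x (Pi.single i 1) =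
      if i = j then 1 else 0 := by
    intro x
    have := (ContinuousLinearMap.proj (R := ℂ) (φ := fun _ : Fin k => ℂ) j).fderiv (x := x)
    change fderiv ℂ (ContinuousLinearMap.proj (R := ℂ) (φ := fun _ : Fin k => ℂ) j) x _ = _
    rw [this]
    simp [Pi.single_apply, eq_comm]
  rw [co_eq, partialDeriv_germOf]
  simp only [h]
  split_ifs <;> rfl

/-- If `f x ≠ 0` at some `x` near `p`, then `f` has no zero near `x`, so the coordinate would vanish
on a neighbourhood of `x`; moving along the `i`-th axis contradicts this. -/
theorem eq_zero_of_co_mul_eq_zero (i : Fin k) (f : Hol k p) (h : co k p i * f = 0) : f = 0 := by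
  obtain ⟨f, hf, rfl⟩ := f.exists_rep
  rw [co_eq, germOf_mul, ← germOf_zero, germOf_eq_iff] at h
  rw [← germOf_zero, germOf_eq_iff]
  filter_upwards [hf.eventually_analyticAt, h.eventually_nhds] with x hx h0
  by_contra hne
  have h1 : ∀ᶠ y in 𝓝 x, y i * f y = 0 ∧ f y ≠ 0 :=
    h0.and (hx.continuousAt.eventually_ne hne)
  have hy : ∀ᶠ y in 𝓝 x, y i = 0 := h1.mono fun y hy => by simpa [hy.2] using hy.1
  have ht : Tendsto (fun c : ℂ => x + Pi.single i c) (𝓝 0) (𝓝 x) := by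
    have : Continuous (fun c : ℂ => x + (Pi.single i c : Fin k → ℂ)) :=
      continuous_const.add (continuous_single (A := fun _ : Fin k => ℂ) i)
    simpa using this.tendsto 0
  have h2 : ∀ᶠ c in 𝓝 (0 : ℂ), x i + c = 0 := (ht.eventually hy).mono fun c hc => by
    simpa using hc
  have h3 : x i = 0 := by simpa using h2.self_of_nhds
  have h4 : ∀ᶠ c in 𝓝[≠] (0 : ℂ), False := by
    filter_upwards [h2.filter_mono nhdsWithin_le_nhds, self_mem_nhdsWithin] with c hc hc'
    exact hc' (by simpa [h3] using hc)
  exact h4.exists.elim fun _ h => h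

/-- Functions as differential operators, as a ring homomorphism. -/
def mulHom : Hol k p →+* DiffOp k p where
  toFun := mulOp
  map_one' := Subtype.ext (LinearMap.ext fun g => one_mul g)
  map_mul' f g := Subtype.ext (LinearMap.ext fun h => mul_assoc f g h)
  map_zero' := Subtype.ext (LinearMap.ext fun g => zero_mul g)
  map_add' f g := Subtype.ext (LinearMap.ext fun h => add_mul f g h)

theorem mulHom_algebraMap (c : ℂ) :
    mulHom (algebraMap ℂ (Hol k p) c) = algebraMap ℂ (DiffOp k p) c :=
  Subtype.ext (LinearMap.ext fun g => (Algebra.smul_def c g).symm)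

theorem pdOp_mul_mulHom (i : Fin k) (f : Hol k p) :
    pdOp i * mulHom f = mulHom f * pdOp i + mulHom (partialDeriv i f) := by
  refine Subtype.ext (LinearMap.ext fun g => ?_)
  change partialDeriv i (f * g) = f * partialDeriv i g + partialDeriv i f * g
  rw [partialDeriv_mul, mul_comm g]

theorem pdOp_comm (i j : Fin k) : Commute (pdOp i : DiffOp k p) (pdOp j) :=
  Subtype.ext (LinearMap.ext fun g => partialDeriv_comm i j g)

theorem mulHom_injective : Function.Injective (mulHom : Hol k p →+* DiffOp k p) := by
  intro f g h
  have := congrArg (fun P : DiffOp k p => P.1 1) h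
  change f * 1 = g * 1 at this
  simpa using this

theorem pdOp_smul_mulHom_smul {X : Type*} [AddCommGroup X] [Module (DiffOp k p) X] (i : Fin k)
    (f : Hol k p) (x : X) :
    (pdOp i : DiffOp k p) • mulHom f • x =
      mulHom f • (pdOp i : DiffOp k p) • x + mulHom (partialDeriv i f) • x := by
  simp only [smul_smul, pdOp_mul_mulHom, add_smul]

theorem pd_eq {a : ℕ} (h : a < k) : pd k p (a + 1) = pdOp ⟨a, h⟩ := dif_pos ⟨by omega, h⟩

theorem pd_comm (a b : ℕ) : Commute (pd k p a) (pd k p b) := by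
  unfold pd
  split_ifs
  · exact pdOp_comm _ _
  · exact Commute.zero_right _
  · exact Commute.zero_left _
  · exact Commute.zero_left _

theorem Eop_eq (μ : ℂ) : Eop k p μ =
    ∑ i : Fin k, mulHom (co k p i) * pdOp i + mulHom (algebraMap ℂ (Hol k p) μ) := by
  have h : Finset.Icc 1 k = (Finset.range k).image (· + 1) := by
    ext a
    simp only [Finset.mem_Icc, Finset.mem_image, Finset.mem_range]
    exact ⟨fun h => ⟨a - 1, by omega, by omega⟩, by rintro ⟨b, hb, rfl⟩; omega⟩
  unfold Eop
  rw [mulHom_algebraMap, h, Finset.sum_image (by intro a _ b _ h; simpa using h),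
    Finset.sum_range]
  exact congrArg (· + _) (Finset.sum_congr rfl fun i _ => by rw [pd_eq i.2]; rfl)

/-- The difference telescopes into generators `A_{i,j}`, each of which moves one unit of index from
the second factor to the first. -/
theorem pd_mul_pd_sub_mem {J : Submodule (DiffOp k p) (DiffOp k p)} (hJ : opsA k p ⊆ J)
    {a b a' b' : ℕ} (ha : a < k) (hb : b < k) (ha' : a' < k) (hb' : b' < k)
    (h : a + b = a' + b') :
    pd k p (a + 1) * pd k p (b + 1) - pd k p (a' + 1) * pd k p (b' + 1) ∈ J := by
  wlog hle : a ≤ a' generalizing a b a' b'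
  · rw [← neg_mem_iff, neg_sub]
    exact this ha' hb' ha hb h.symm (by omega)
  obtain ⟨m, rfl⟩ := Nat.exists_eq_add_of_le hle
  obtain rfl : b = b' + m := by omega
  clear hle h
  induction m generalizing b' with
  | zero => simp
  | succ m ih =>
    have h1 := ih (b' := b' + 1) (by omega) (by omega) (by omega)
    have h2 : pd k p (a + m + 1) * pd k p (b' + 1 + 1) -
        pd k p (a + m + 1 + 1) * pd k p (b' + 1 + 1 - 1) ∈ J :=
      hJ ⟨a + m + 1, b' + 1 + 1, by omega, by omega, by omega, by omega, rfl⟩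
    have h3 := J.add_mem h1 h2
    rw [sub_add_sub_cancel] at h3
    rwa [show b' + (m + 1) = b' + 1 + m by ring]

theorem diffOp_induction {C : DiffOp k p → Prop} (hf : ∀ f, C (mulHom f)) (hpd : ∀ i, C (pdOp i))
    (hadd : ∀ P Q, C P → C Q → C (P + Q)) (hmul : ∀ P Q, C P → C Q → C (P * Q))
    (P : DiffOp k p) : C P := by
  obtain ⟨P, hP⟩ := P
  induction hP using Algebra.adjoin_induction with
  | mem x hx =>
    rcases hx with ⟨f, rfl⟩ | ⟨i, rfl⟩
    · exact hf f
    · exact hpd i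
  | algebraMap r => 
    have := hf (algebraMap ℂ (Hol k p) r)
    rwa [mulHom_algebraMap] at this
  | add x y hx hy h1 h2 => exact hadd _ _ h1 h2
  | mul x y hx hy h1 h2 => exact hmul _ _ h1 h2

theorem smul_mem_of_stable {X : Type*} [AddCommGroup X] [Module (DiffOp k p) X]
    (Y : AddSubgroup X) (hf : ∀ (f : Hol k p), ∀ y ∈ Y, mulHom f • y ∈ Y)
    (hpd : ∀ (i : Fin k), ∀ y ∈ Y, (pdOp i : DiffOp k p) • y ∈ Y) (P : DiffOp k p) :
    ∀ y ∈ Y, P • y ∈ Y := by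
  refine diffOp_induction (C := fun P => ∀ y ∈ Y, P • y ∈ Y) hf hpd ?_ ?_ P
  · intro P Q h1 h2 y hy
    rw [add_smul]
    exact Y.add_mem (h1 y hy) (h2 y hy)
  · intro P Q h1 h2 y hy
    rw [mul_smul]
    exact h1 _ (h2 y hy)

/-- An additive map commuting with functions and derivations is linear over `D_{N,p}`. -/
def mkLinear {X Y : Type*} [AddCommGroup X] [Module (DiffOp k p) X] [AddCommGroup Y]
    [Module (DiffOp k p) Y] (φ : X →+ Y) (hf : ∀ (f : Hol k p) x, φ (mulHom f • x) = mulHom f • φ x)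
    (hpd : ∀ (i : Fin k) x, φ ((pdOp i : DiffOp k p) • x) = (pdOp i : DiffOp k p) • φ x) :
    X →ₗ[DiffOp k p] Y where
  __ := φ
  map_smul' P x := by
    refine diffOp_induction (C := fun P => ∀ x, φ (P • x) = P • φ x) hf hpd ?_ ?_ P x
    · intro P Q h1 h2 x
      rw [add_smul, map_add, h1, h2, add_smul]
    · intro P Q h1 h2 x
      rw [mul_smul, h1, h2, mul_smul]

/-! ### Normal form of differential operators and the presentation of `DiffOp` -/

section Ordered

variable {O E : Type*} [CommRing O] [Ring E] (c : O →+* E) (X : Fin k → E)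
  (hX : ∀ i j, Commute (X i) (X j))

include hX in
theorem pairwise_commute_powersHom : Pairwise fun i j => ∀ x y : Multiplicative ℕ,
    Commute (powersHom E (X i) x) (powersHom E (X j) y) :=
  fun i j _ _ _ => (hX i j).pow_pow _ _

/-- The monomials in a family of commuting elements of a ring. -/
def monoHom : Multiplicative (Fin k →₀ ℕ) →* E where
  toFun α := MonoidHom.noncommPiCoprod _ (pairwise_commute_powersHom X hX)
    (fun i => Multiplicative.ofAdd (α.toAdd i))
  map_one' := map_one (MonoidHom.noncommPiCoprod _ (pairwise_commute_powersHom X hX))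
  map_mul' α β := map_mul (MonoidHom.noncommPiCoprod _ (pairwise_commute_powersHom X hX))
    (fun i => Multiplicative.ofAdd (α.toAdd i)) (fun i => Multiplicative.ofAdd (β.toAdd i))

theorem monoHom_single (i : Fin k) :
    monoHom X hX (Multiplicative.ofAdd (Finsupp.single i 1)) = X i := by
  have h : (fun j => Multiplicative.ofAdd ((Finsupp.single i 1 : Fin k →₀ ℕ) j)) =
      Pi.mulSingle i (Multiplicative.ofAdd 1) := by
    funext j
    by_cases h : j = i
    · subst h; simp
    · rw [Finsupp.single_apply, if_neg (Ne.symm h), Pi.mulSingle_eq_of_ne h]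
      rfl
  change MonoidHom.noncommPiCoprod _ (pairwise_commute_powersHom X hX)
    (fun j => Multiplicative.ofAdd ((Finsupp.single i 1 : Fin k →₀ ℕ) j)) = X i
  rw [h, MonoidHom.noncommPiCoprod_mulSingle]
  simp

/-- Evaluation of a polynomial at a family of commuting elements, coefficients on the left. -/
def ordEval : MvPolynomial (Fin k) O →+ E :=
  AddMonoidAlgebra.liftNC (c : O →+ E) (monoHom X hX)

/-- Coefficients need not commute with the `X i`, so `ordEval` is not multiplicative in general. Two
kinds of products survive: a constant on the left, and a variable (with coefficients `0` and `1`) on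
the right. -/
theorem ordEval_C_mul (f : O) (q : MvPolynomial (Fin k) O) :
    ordEval c X hX (MvPolynomial.C f * q) = c f * ordEval c X hX q := by
  have h1 : ordEval c X hX (MvPolynomial.C f) = c f := by
    refine (AddMonoidAlgebra.liftNC_single _ _ _ _).trans ?_
    rw [ofAdd_zero, map_one, mul_one]
    rfl
  rw [← h1]
  refine AddMonoidAlgebra.liftNC_mul c (monoHom X hX) _ _ fun {x y} hy => ?_
  have : y = 0 := by
    have h2 := Finsupp.support_single_subset hy
    simpa using h2
  rw [this, ofAdd_zero, map_one]
  exact Commute.one_right _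

theorem ordEval_mul_X (q : MvPolynomial (Fin k) O) (i : Fin k) :
    ordEval c X hX (q * MvPolynomial.X i) = ordEval c X hX q * X i := by
  have h1 : ordEval c X hX (MvPolynomial.X i) = X i := by
    refine (AddMonoidAlgebra.liftNC_single _ _ _ _).trans ?_
    rw [monoHom_single]
    simp
  rw [← h1]
  refine AddMonoidAlgebra.liftNC_mul c (monoHom X hX) _ _ fun {x y} _ => ?_
  change Commute (c (MvPolynomial.coeff x (MvPolynomial.X i))) _
  rw [MvPolynomial.coeff_X]
  split_ifs
  · rw [map_one]; exact Commute.one_left _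
  · rw [map_zero]; exact Commute.zero_left _

theorem ordEval_one : ordEval c X hX 1 = 1 := AddMonoidAlgebra.liftNC_one _ _

theorem ordEval_C (f : O) : ordEval c X hX (MvPolynomial.C f) = c f := by
  rw [← mul_one (MvPolynomial.C f), ordEval_C_mul, ordEval_one, mul_one]

end Ordered

/-- The operator attached to a polynomial in the derivations. -/
abbrev opOf : MvPolynomial (Fin k) (Hol k p) →+ DiffOp k p := ordEval mulHom pdOp pdOp_comm

theorem opOf_mul_co (i : Fin k) (q : MvPolynomial (Fin k) (Hol k p)) :
    opOf q * mulHom (co k p i) = mulHom (co k p i) * opOf q + opOf (MvPolynomial.pderiv i q) := by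
  induction q using MvPolynomial.induction_on with
  | C f => simp [ordEval_C, ← map_mul, mul_comm]
  | add a b ha hb => simp only [map_add, add_mul, mul_add, ha, hb]; abel
  | mul_X a j ha =>
    rw [ordEval_mul_X, mul_assoc, pdOp_mul_mulHom, partialDeriv_co, mul_add, ← mul_assoc, ha,
      Derivation.leibniz, MvPolynomial.pderiv_X, smul_eq_mul, smul_eq_mul, map_add,
      mul_comm (MvPolynomial.X j), ordEval_mul_X]
    by_cases h : i = j
    · subst h
      simp [add_mul, mul_assoc]
      abel
    · simp [Ne.symm h, add_mul, mul_assoc]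

/-- The commutator with `σ_i` differentiates the polynomial in its `i`-th variable, so all its
partial derivatives are again killed and have lower degree. By induction they vanish, and in
characteristic zero only a constant is left. -/
theorem opOf_injective : Function.Injective (opOf (k := k) (p := p)) := by
  rw [injective_iff_map_eq_zero]
  have main : ∀ n : ℕ, ∀ q : MvPolynomial (Fin k) (Hol k p),
      (∀ α, n < α.degree → q.coeff α = 0) → opOf q = 0 → q = 0 := by
    intro n
    induction n with
    | zero =>
      intro q hq h
      have hC : q = MvPolynomial.C (q.coeff 0) := by
        ext α
        rw [MvPolynomial.coeff_C]
        split_ifs with h0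
        · rw [h0]
        · exact hq α (Nat.pos_of_ne_zero fun h1 => h0 ((Finsupp.degree_eq_zero_iff α).1 h1).symm)
      rw [hC, ordEval_C] at h
      rw [hC, mulHom_injective (h.trans (map_zero _).symm), map_zero]
    | succ n ih =>
      intro q hq h
      have hd : ∀ i, MvPolynomial.pderiv i q = 0 := by
        intro i
        refine ih _ (fun α hα => ?_) ?_
        · rw [MvPolynomial.coeff_pderiv, hq _ (by simpa [Finsupp.degree_single] using hα), zero_mul]
        · have := opOf_mul_co i q
          simpa [h] using this.symm
      refine ih q (fun α hα => ?_) h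
      obtain ⟨i, hi⟩ : ∃ i, α i ≠ 0 := by
        by_contra! h0
        rw [show α = 0 from Finsupp.ext h0, map_zero] at hα
        omega
      have hle : Finsupp.single i 1 ≤ α := by
        rw [Finsupp.single_le_iff]
        omega
      have := congrArg (MvPolynomial.coeff (α - Finsupp.single i 1)) (hd i)
      rw [MvPolynomial.coeff_pderiv, tsub_add_cancel_of_le hle, MvPolynomial.coeff_zero] at this
      -- This is the exponent `α i`, a nonzero integer, hence invertible in a `ℂ`-algebra.
      have hu : IsUnit ((((α - Finsupp.single i 1 : Fin k →₀ ℕ) i : ℕ) : Hol k p) + 1) := by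
        have := (isUnit_iff_ne_zero.2 (Nat.cast_add_one_ne_zero (R := ℂ)
          ((α - Finsupp.single i 1 : Fin k →₀ ℕ) i))).map (algebraMap ℂ (Hol k p))
        simpa using this
      exact (hu.mul_left_eq_zero).1 this
  exact fun q => main q.totalDegree q fun α hα =>
    MvPolynomial.coeff_eq_zero_of_totalDegree_lt hα

theorem opOf_surjective : Function.Surjective (opOf (k := k) (p := p)) := by
  have hmul : ∀ P ∈ (opOf (k := k) (p := p)).range, ∀ j,
      P * pdOp j ∈ (opOf (k := k) (p := p)).range := by
    rintro _ ⟨q, rfl⟩ j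
    exact ⟨_, ordEval_mul_X _ _ _ q j⟩
  have hf : ∀ f, ∀ P ∈ (opOf (k := k) (p := p)).range,
      mulHom f * P ∈ (opOf (k := k) (p := p)).range := by
    rintro f _ ⟨q, rfl⟩
    exact ⟨_, ordEval_C_mul _ _ _ f q⟩
  have hpd : ∀ i, ∀ P ∈ (opOf (k := k) (p := p)).range,
      pdOp i * P ∈ (opOf (k := k) (p := p)).range := by
    rintro i _ ⟨q, rfl⟩
    induction q using MvPolynomial.induction_on with
    | C f =>
      rw [ordEval_C, pdOp_mul_mulHom]
      refine add_mem (hmul _ ⟨_, ordEval_C _ _ _ f⟩ i) ⟨_, ordEval_C _ _ _ _⟩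
    | add a b ha hb => rw [map_add, mul_add]; exact add_mem ha hb
    | mul_X a j ha => rw [ordEval_mul_X, ← mul_assoc]; exact hmul _ ha j
  intro P
  have := smul_mem_of_stable (X := DiffOp k p) (opOf (k := k) (p := p)).range hf hpd P 1 ⟨1, ordEval_one _ _ _⟩
  simpa using this

/-- Operators are polynomials in the derivations with coefficients on the left. -/
def opEquiv : MvPolynomial (Fin k) (Hol k p) ≃+ DiffOp k p :=
  AddEquiv.ofBijective opOf ⟨opOf_injective, opOf_surjective⟩

section Extend

variable {E : Type*} [Ring E] (c : Hol k p →+* E) (X : Fin k → E)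
  (hX : ∀ i j, Commute (X i) (X j))
  (hc : ∀ i f, X i * c f = c f * X i + c (partialDeriv i f))

/-- `D_{N,p}` is presented by functions and derivations. -/
def extAdd : DiffOp k p →+ E := (ordEval c X hX).comp (opEquiv (k := k) (p := p)).symm.toAddMonoidHom

theorem extAdd_opOf (q : MvPolynomial (Fin k) (Hol k p)) :
    extAdd c X hX (opOf q) = ordEval c X hX q :=
  congrArg (ordEval c X hX) ((opEquiv (k := k) (p := p)).symm_apply_apply q)

theorem extAdd_mul_pdOp (P : DiffOp k p) (j : Fin k) :
    extAdd c X hX (P * pdOp j) = extAdd c X hX P * X j := by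
  obtain ⟨q, rfl⟩ := opOf_surjective P
  rw [← ordEval_mul_X, extAdd_opOf, extAdd_opOf, ordEval_mul_X]

theorem extAdd_mulHom_mul (f : Hol k p) (P : DiffOp k p) :
    extAdd c X hX (mulHom f * P) = c f * extAdd c X hX P := by
  obtain ⟨q, rfl⟩ := opOf_surjective P
  rw [← ordEval_C_mul, extAdd_opOf, extAdd_opOf, ordEval_C_mul]

theorem extAdd_one : extAdd c X hX 1 = 1 := by
  rw [← ordEval_one mulHom pdOp pdOp_comm, extAdd_opOf, ordEval_one]

theorem extAdd_mulHom (f : Hol k p) : extAdd c X hX (mulHom f) = c f := by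
  rw [← mul_one (mulHom f), extAdd_mulHom_mul, extAdd_one, mul_one]

theorem extAdd_pdOp (i : Fin k) : extAdd c X hX (pdOp i) = X i := by
  rw [← one_mul (pdOp i), extAdd_mul_pdOp, extAdd_one, one_mul]

-- Right multiplication by `pdOp j` is compatible by construction; on the left the derivation must
-- first cross the coefficients, and here the Leibniz hypothesis `hc` enters.
include hc in
theorem extAdd_pdOp_mul (i : Fin k) (P : DiffOp k p) :
    extAdd c X hX (pdOp i * P) = X i * extAdd c X hX P := by
  obtain ⟨q, rfl⟩ := opOf_surjective P
  induction q using MvPolynomial.induction_on with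
  | C f => rw [ordEval_C, pdOp_mul_mulHom, map_add, extAdd_mul_pdOp, extAdd_mulHom, extAdd_mulHom, hc]
  | add a b ha hb => simp only [map_add, mul_add, ha, hb]
  | mul_X a j ha => rw [ordEval_mul_X, ← mul_assoc, extAdd_mul_pdOp, ha, extAdd_mul_pdOp, mul_assoc]

include hc in
theorem extAdd_mul (P Q : DiffOp k p) :
    extAdd c X hX (P * Q) = extAdd c X hX P * extAdd c X hX Q := by
  refine diffOp_induction (C := fun P => ∀ Q, extAdd c X hX (P * Q) = extAdd c X hX P * extAdd c X hX Q)
    ?_ ?_ ?_ ?_ P Q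
  · intro f Q
    rw [extAdd_mulHom_mul, extAdd_mulHom]
  · intro f Q
    rw [extAdd_pdOp_mul c X hX hc, extAdd_pdOp]
  · intro P Q h1 h2 R
    rw [add_mul, map_add, h1, h2, map_add, add_mul]
  · intro P Q h1 h2 R
    rw [mul_assoc, h1, h2, h1, mul_assoc]

/-- The ring homomorphism on `D_{N,p}` given by images of functions and derivations that satisfy
the Leibniz rule. -/
def extHom : DiffOp k p →+* E where
  __ := extAdd c X hX
  map_one' := extAdd_one c X hX
  map_mul' := extAdd_mul c X hX hc

theorem extHom_mulHom (f : Hol k p) : extHom c X hX hc (mulHom f) = c f := extAdd_mulHom c X hX f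

theorem extHom_pdOp (i : Fin k) : extHom c X hX hc (pdOp i) = X i := extAdd_pdOp c X hX i

end Extend

/-! ### The symbol module `𝒪[t][s]` and the operators `symEuler`, `symRel` -/

section

open Polynomial

/-- The derivation of `A[X]` acting on coefficients. -/
def coefDer {A : Type*} [CommRing A] [Algebra ℂ A] (d : Derivation ℂ A A) :
    Derivation ℂ A[X] A[X] :=
  PolynomialModule.equivPolynomialSelf.compDer d.mapCoeffs

section coefDer

variable {A : Type*} [CommRing A] [Algebra ℂ A] (d : Derivation ℂ A A)

@[simp]
theorem coeff_coefDer (q : A[X]) (n : ℕ) : (coefDer d q).coeff n = d (q.coeff n) := rfl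

@[simp]
theorem coefDer_C (a : A) : coefDer d (C a) = C (d a) := by
  ext n
  simp [coeff_C, apply_ite d]

@[simp]
theorem coefDer_X : coefDer d X = 0 := by
  ext n
  simp [coeff_X, apply_ite d]

theorem coefDer_comm {d e : Derivation ℂ A A} (h : ∀ a, d (e a) = e (d a)) (q : A[X]) :
    coefDer d (coefDer e q) = coefDer e (coefDer d q) := by
  ext n
  simp [h]

theorem derivative_coefDer (q : A[X]) :
    derivative (coefDer d q) = coefDer d (derivative q) := by
  ext n
  have : d ((n : A) + 1) = 0 := by simp
  simp [coeff_derivative, this]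
  ring

end coefDer

/-- The module of total symbols `𝒪[t][s]`. -/
abbrev Symb (k : ℕ) (p : Fin k → ℂ) : Type := (Hol k p)[X][X]

/-- The action of a derivation on coefficients of symbols. -/
def symDer (i : Fin k) : Derivation ℂ (Symb k p) (Symb k p) := coefDer (coefDer (pdDer i))

theorem symDer_comm (i j : Fin k) (b : Symb k p) :
    symDer i (symDer j b) = symDer j (symDer i b) :=
  coefDer_comm (coefDer_comm (partialDeriv_comm i j)) b

@[simp]
theorem symDer_X (i : Fin k) : symDer i (X : Symb k p) = 0 := coefDer_X _

@[simp]
theorem symDer_C_X (i : Fin k) : symDer i (C X : Symb k p) = 0 := by simp [symDer]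

@[simp]
theorem symDer_C_C (i : Fin k) (f : Hol k p) :
    symDer i (C (C f) : Symb k p) = C (C (partialDeriv i f)) := by simp [symDer]

/-- The action of `∂_{i+1}` on symbols, in which `∂_{i+1}` has symbol `s t^i`. -/
def symConn (i : Fin k) : AddMonoid.End (Symb k p) :=
  AddMonoidHom.mk' (fun b : Symb k p => symDer i b + X * C X ^ (i : ℕ) * b) fun a b => by
    rw [map_add]
    ring

theorem symConn_apply (i : Fin k) (b : Symb k p) :
    symConn i b = symDer i b + X * C X ^ (i : ℕ) * b := rfl

theorem symConn_commute (i j : Fin k) : Commute (symConn (k := k) (p := p) i) (symConn j) := by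
  refine AddMonoidHom.ext fun b => ?_
  change symConn i (symConn j b) = symConn j (symConn i b)
  simp only [symConn_apply, map_add, Derivation.leibniz, symDer_comm i j,
    Derivation.leibniz_pow, symDer_X, symDer_C_X, smul_eq_mul, mul_zero, smul_zero, add_zero]
  ring

theorem symConn_leibniz (i : Fin k) (f : Hol k p) :
    symConn i * Module.toAddMonoidEnd (Hol k p) (Symb k p) f =
      Module.toAddMonoidEnd (Hol k p) (Symb k p) f * symConn i +
        Module.toAddMonoidEnd (Hol k p) (Symb k p) (partialDeriv i f) := by
  refine AddMonoidHom.ext fun b => ?_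
  change symConn i (f • b) = f • symConn i b + partialDeriv i f • b
  have h : ∀ (f : Hol k p) (b : Symb k p), f • b = C (C f) * b := fun f b => by
    simp [Algebra.smul_def, Polynomial.algebraMap_apply]
  simp only [symConn_apply, h, Derivation.leibniz, smul_eq_mul, symDer_C_C]
  ring

instance symModule : Module (DiffOp k p) (Symb k p) :=
  Module.compHom _ (extHom (Module.toAddMonoidEnd (Hol k p) (Symb k p)) symConn
    symConn_commute symConn_leibniz)

theorem mulHom_smul_symb (f : Hol k p) (b : Symb k p) : mulHom f • b = C (C f) * b := by
  refine (congrArg (fun F : AddMonoid.End (Symb k p) => F b)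
    (extHom_mulHom _ _ symConn_commute symConn_leibniz f)).trans ?_
  change f • b = _
  simp [Algebra.smul_def, Polynomial.algebraMap_apply]

theorem pdOp_smul_symb (i : Fin k) (b : Symb k p) :
    (pdOp i : DiffOp k p) • b = symDer i b + X * C X ^ (i : ℕ) * b :=
  congrArg (fun F : AddMonoid.End (Symb k p) => F b)
    (extHom_pdOp _ _ symConn_commute symConn_leibniz i)

/-- The symbol of `E` divided by `s`. -/
def symQ (k : ℕ) (p : Fin k → ℂ) : (Hol k p)[X] := ∑ i : Fin k, C (co k p i) * X ^ (i : ℕ)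

theorem coefDer_symQ (i : Fin k) : coefDer (pdDer i) (symQ k p) = X ^ (i : ℕ) := by
  simp [symQ, Derivation.leibniz, Derivation.leibniz_pow, partialDeriv_co, apply_ite]

theorem coeff_symQ (i : Fin k) : (symQ k p).coeff i = co k p i := by
  simp [symQ, coeff_X_pow, Fin.val_inj]

theorem coeff_symQ_of_le {r : ℕ} (hr : k ≤ r) : (symQ k p).coeff r = 0 := by
  simp only [symQ, finsetSum_coeff, coeff_C_mul, coeff_X_pow]
  exact Finset.sum_eq_zero fun i _ => by rw [if_neg (by omega), mul_zero]

/-- Right multiplication by `E + μ` on symbols. -/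
def symEuler (μ : ℂ) : Symb k p →ₗ[DiffOp k p] Symb k p :=
  mkLinear
    -- The term `s ∂/∂s` is forced by `D`-linearity: the commutator of `symDer i` with `s Q` is `s
    -- t^i`, and that of `s t^i` with `s ∂/∂s` is `-s t^i`.
    (AddMonoidHom.mulLeft (X * C (symQ k p) + C (C (algebraMap ℂ (Hol k p) μ))) +
      (AddMonoidHom.mulLeft X).comp (derivative (R := (Hol k p)[X])).toAddMonoidHom)
    (fun f b => by
      simp only [mulHom_smul_symb, AddMonoidHom.add_apply, AddMonoidHom.coe_mulLeft,
        AddMonoidHom.comp_apply, LinearMap.toAddMonoidHom_coe, derivative_mul, derivative_C]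
      ring)
    (fun i b => by
      have h1 : symDer i (C (symQ k p) : Symb k p) = C X ^ (i : ℕ) := by
        rw [symDer, coefDer_C, coefDer_symQ, C_pow]
      have h2 : symDer i (C (C (algebraMap ℂ (Hol k p) μ)) : Symb k p) = 0 := by
        rw [symDer_C_C, ← pdDer_apply, Derivation.map_algebraMap, C_0, C_0]
      have h3 : derivative (symDer i b) = symDer i (derivative b) := derivative_coefDer _ _
      simp only [pdOp_smul_symb, AddMonoidHom.add_apply, AddMonoidHom.coe_mulLeft,
        AddMonoidHom.comp_apply, LinearMap.toAddMonoidHom_coe, derivative_mul, derivative_C, map_add,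
        derivative_X, derivative_pow, h3, Derivation.leibniz, h1, h2, smul_eq_mul, symDer_X]
      ring)

theorem symEuler_apply (μ : ℂ) (b : Symb k p) : symEuler μ b =
    (X * C (symQ k p) + C (C (algebraMap ℂ (Hol k p) μ))) * b + X * derivative b := rfl

/-- The operator on symbols through which the relations `T^m_μ` act. -/
def symRel (μ : ℂ) : Symb k p →ₗ[DiffOp k p] Symb k p :=
  mkLinear
    (AddMonoidHom.mulLeft X +
      (AddMonoidHom.mulLeft (C X)).comp (symEuler μ).toAddMonoidHom)
    (fun f b => by
      change X * (mulHom f • b) + C X * symEuler μ (mulHom f • b) =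
        mulHom f • (X * b + C X * symEuler μ b)
      rw [map_smul]
      simp only [mulHom_smul_symb]
      ring)
    (fun i b => by
      change X * ((pdOp i : DiffOp k p) • b) + C X * symEuler μ ((pdOp i : DiffOp k p) • b) =
        (pdOp i : DiffOp k p) • (X * b + C X * symEuler μ b)
      rw [map_smul]
      simp only [pdOp_smul_symb, map_add, Derivation.leibniz, symDer_X, symDer_C_X, smul_eq_mul]
      ring)

theorem symRel_apply (μ : ℂ) (b : Symb k p) : symRel μ b = X * b + C X * symEuler μ b := rfl

/-- The shift of `μ` comes from `∂/∂s` hitting the factor `s`; it is what turns `ℐ_μ` into `ℐ_{μ+1}`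
in the injectivity argument. -/
theorem symEuler_X_mul (μ : ℂ) (b : Symb k p) :
    symEuler μ (X * b) = X * symEuler (μ + 1) b := by
  simp only [symEuler_apply, derivative_mul, derivative_X, map_add, map_one]
  ring

theorem symEuler_one (μ : ℂ) : symEuler μ (1 : Symb k p) = Eop k p μ • (1 : Symb k p) := by
  have h : ∀ i : Fin k, (mulHom (co k p i) * pdOp i : DiffOp k p) • (1 : Symb k p) =
      X * C (C (co k p i) * X ^ (i : ℕ)) := fun i => by
    rw [mul_smul, pdOp_smul_symb, mulHom_smul_symb, Derivation.map_one_eq_zero, C_mul, C_pow]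
    ring
  rw [symEuler_apply, Eop_eq, add_smul, Finset.sum_smul, Finset.sum_congr rfl fun i _ => h i,
    ← Finset.mul_sum, ← map_sum, mulHom_smul_symb, derivative_one, mul_zero, add_zero, mul_one,
    mul_one]
  rfl

theorem smul_symEuler_one (μ : ℂ) (P : DiffOp k p) :
    symEuler μ (P • (1 : Symb k p)) = (P * Eop k p μ) • (1 : Symb k p) := by
  rw [map_smul, symEuler_one, mul_smul]

/-- Symbols whose coefficient at `s^q t^r` vanishes for `q (k-1) + e ≤ r`. -/
def symWt (k : ℕ) (p : Fin k → ℂ) (e : ℕ) : Submodule (DiffOp k p) (Symb k p) where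
  carrier := {b | ∀ q r, q * (k - 1) + e ≤ r → (b.coeff q).coeff r = 0}
  add_mem' := fun {a b} ha hb q r h => by simp [ha q r h, hb q r h]
  zero_mem' := fun q r h => by simp
  smul_mem' P b hb := by
    let Y : AddSubgroup (Symb k p) :=
      { carrier := {b | ∀ q r, q * (k - 1) + e ≤ r → (b.coeff q).coeff r = 0}
        add_mem' := fun {a b} ha hb q r h => by simp [ha q r h, hb q r h]
        zero_mem' := fun q r h => by simp
        neg_mem' := fun {a} ha q r h => by simp [ha q r h] }
    refine smul_mem_of_stable Y ?_ ?_ P b hb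
    · intro f y hy q r h
      rw [mulHom_smul_symb, coeff_C_mul, coeff_C_mul, hy q r h, mul_zero]
    · intro i y hy q r h
      rw [pdOp_smul_symb, coeff_add, coeff_add]
      have h1 : ((symDer i y).coeff q).coeff r = 0 := by
        change pdDer i ((y.coeff q).coeff r) = 0
        rw [hy q r h, map_zero]
      rw [h1, zero_add, mul_assoc, ← C_pow]
      cases q with
      | zero => simp
      | succ q =>
        rw [coeff_X_mul, coeff_C_mul, coeff_X_pow_mul']
        split_ifs with hr
        · refine hy q _ ?_
          have : q * (k - 1) + (k - 1) + e ≤ r := by rw [← Nat.succ_mul]; exact h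
          omega
        · rfl

theorem symWt_induction {e : ℕ} (G : AddSubgroup (Symb k p))
    (hG : ∀ q r f, r < q * (k - 1) + e → monomial q (monomial r f) ∈ G) {b : Symb k p}
    (hb : b ∈ symWt k p e) : b ∈ G := by
  rw [b.as_sum_support]
  refine sum_mem fun q _ => ?_
  rw [(b.coeff q).as_sum_support, map_sum]
  refine sum_mem fun r hr => hG q r _ ?_
  by_contra! h
  exact (mem_support_iff.1 hr) (hb q r h)

theorem one_mem_symWt : (1 : Symb k p) ∈ symWt k p 1 := by
  intro q r h
  rw [coeff_one]
  split_ifs with hq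
  · rw [coeff_one, if_neg (by omega)]
  · rfl

end

/-! ### The ideals seen on symbols, and injectivity of right multiplication by `E + μ` -/

section

open Polynomial

/-- A monomial of degree `q` and weight `r` in the derivations. -/
def wtMon (k : ℕ) (p : Fin k → ℂ) : ℕ → ℕ → DiffOp k p
  | 0, _ => 1
  | q + 1, r => pd k p (min r (k - 1) + 1) * wtMon k p q (r - (k - 1))

theorem pd_comm_wtMon (a q r : ℕ) : Commute (pd k p a) (wtMon k p q r) := by
  induction q generalizing r with
  | zero => exact Commute.one_right _
  | succ q ih => exact (pd_comm _ _).mul_right (ih _)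

/-- Modulo the `A_{i,j}` a monomial depends only on its order and total weight. `wtMon` is the
greedy representative, made of as many `∂_k` as the weight allows; `hr` ensures that the `q` factors
can absorb all of the weight `r`. -/
theorem pd_mul_wtMon_sub_mem {J : Submodule (DiffOp k p) (DiffOp k p)} (hJ : opsA k p ⊆ J)
    {h q r : ℕ} (hh : h < k) (hr : r ≤ q * (k - 1)) :
    pd k p (h + 1) * wtMon k p q r - wtMon k p (q + 1) (r + h) ∈ J := by
  have key : ∀ {a b a' b' q r : ℕ}, a < k → b < k → a' < k → b' < k → a + b = a' + b' →
      pd k p (a + 1) * (pd k p (b + 1) * wtMon k p q r) -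
        pd k p (a' + 1) * (pd k p (b' + 1) * wtMon k p q r) ∈ J := by
    intro a b a' b' q r ha hb ha' hb' hs
    have h1 := J.smul_mem (wtMon k p q r) (pd_mul_pd_sub_mem hJ ha hb ha' hb' hs)
    rwa [smul_eq_mul, mul_sub, ← ((pd_comm_wtMon _ q r).mul_left (pd_comm_wtMon _ q r)).eq,
      ← ((pd_comm_wtMon _ q r).mul_left (pd_comm_wtMon _ q r)).eq, mul_assoc, mul_assoc] at h1
  induction q generalizing r with
  | zero =>
    obtain rfl : r = 0 := by omega
    simp [wtMon, min_eq_left (show h ≤ k - 1 by omega)]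
  | succ q ih =>
    rw [Nat.succ_mul] at hr
    rw [wtMon, wtMon]
    rcases le_total (k - 1) r with hk | hk
    · rw [min_eq_right hk, min_eq_right (by omega), show r + h - (k - 1) = r - (k - 1) + h by omega,
        ← mul_assoc, (pd_comm _ _).eq, mul_assoc, ← mul_sub]
      exact J.smul_mem _ (ih (by omega))
    · rw [min_eq_left hk, Nat.sub_eq_zero_of_le hk, wtMon]
      rcases le_total (r + h) (k - 1) with hs | hs
      · rw [min_eq_left hs, Nat.sub_eq_zero_of_le hs, Nat.zero_min, Nat.zero_sub]
        exact key hh (by omega) (by omega) (by omega) (by omega)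
      · rw [min_eq_right hs, min_eq_left (by omega), Nat.sub_eq_zero_of_le (n := r + h - (k - 1)) (by omega)]
        exact key hh (by omega) (by omega) (by omega) (by omega)

/-- A section of the symbol map. -/
def ofSymb : Symb k p →+ DiffOp k p :=
  (lsum (R := ℤ) fun q => (lsum (R := ℤ) fun r =>
    ((AddMonoidHom.mulRight (wtMon k p q r)).comp
      (mulHom (k := k) (p := p)).toAddMonoidHom).toIntLinearMap)).toAddMonoidHom

theorem ofSymb_monomial (q r : ℕ) (f : Hol k p) :
    ofSymb (monomial q (monomial r f)) = mulHom f * wtMon k p q r := by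
  simp [ofSymb, lsum_apply, sum_monomial_index]

theorem pdOp_smul_monomial (i : Fin k) (q r : ℕ) (f : Hol k p) :
    (pdOp i : DiffOp k p) • (monomial q (monomial r f) : Symb k p) =
      monomial q (monomial r (partialDeriv i f)) + monomial (q + 1) (monomial (r + i) f) := by
  have h : symDer i (monomial q (monomial r f) : Symb k p) =
      monomial q (monomial r (partialDeriv i f)) := by
    ext a b
    change pdDer i (((monomial q (monomial r f)).coeff a).coeff b) = _
    simp only [coeff_monomial]
    split_ifs <;> simp [coeff_monomial]
    split_ifs <;> simp
  rw [pdOp_smul_symb, h]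
  congr 1
  rw [mul_assoc, ← C_pow, C_mul_monomial, X_pow_mul_monomial, X_mul_monomial]

theorem mulHom_smul_monomial (g : Hol k p) (q r : ℕ) (f : Hol k p) :
    mulHom g • (monomial q (monomial r f) : Symb k p) = monomial q (monomial r (g * f)) := by
  rw [mulHom_smul_symb, C_mul_monomial, C_mul_monomial]

theorem smul_one_mem_symWt (P : DiffOp k p) : P • (1 : Symb k p) ∈ symWt k p 1 :=
  Submodule.smul_mem _ P one_mem_symWt

/-- Passing to the symbol and back replaces monomials by greedy ones, which changes nothing modulo
the `A_{i,j}`. The operators with this property contain `1` and are stable under left multiplication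
by functions and derivations. -/
theorem ofSymb_smul_one_sub_mem {J : Submodule (DiffOp k p) (DiffOp k p)} (hJ : opsA k p ⊆ J)
    (P : DiffOp k p) : ofSymb (P • (1 : Symb k p)) - P ∈ J := by
  let Y : AddSubgroup (DiffOp k p) :=
    { carrier := {P | ofSymb (P • (1 : Symb k p)) - P ∈ J}
      add_mem' := fun {a b} ha hb => by
        have := J.add_mem ha hb
        rwa [sub_add_sub_comm, ← map_add, ← add_smul] at this
      zero_mem' := by simp
      neg_mem' := fun {a} ha => by
        have := J.neg_mem ha
        rwa [neg_sub', ← map_neg, ← neg_smul] at this }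
  have h1 : (1 : DiffOp k p) ∈ Y := by
    change ofSymb ((1 : DiffOp k p) • (1 : Symb k p)) - 1 ∈ J
    have := ofSymb_monomial (k := k) (p := p) 0 0 1
    rw [one_smul, show (1 : Symb k p) = monomial 0 (monomial 0 1) from rfl, this]
    simp [wtMon]
  have := smul_mem_of_stable Y ?_ ?_ P 1 h1
  · rwa [smul_eq_mul, mul_one] at this
  · intro f P hP
    have h := J.smul_mem (mulHom f) hP
    have hlin : ∀ b : Symb k p, ofSymb (mulHom f • b) = mulHom f * ofSymb b := by
      intro b
      induction b using Polynomial.induction_on' with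
      | add a b ha hb => rw [smul_add, map_add, map_add, ha, hb, mul_add]
      | monomial q c =>
        induction c using Polynomial.induction_on' with
        | add a b ha hb => rw [map_add, smul_add, map_add, map_add, ha, hb, mul_add]
        | monomial r g => rw [mulHom_smul_monomial, ofSymb_monomial, ofSymb_monomial, map_mul, mul_assoc]
    change ofSymb ((mulHom f * P) • (1 : Symb k p)) - mulHom f * P ∈ J
    rwa [mul_smul, hlin, ← mul_sub]
  · intro i P hP
    let G : AddSubgroup (Symb k p) :=
      { carrier := {b | ofSymb ((pdOp i : DiffOp k p) • b) - pdOp i * ofSymb b ∈ J}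
        add_mem' := fun {a b} ha hb => by
          have := J.add_mem ha hb
          rwa [sub_add_sub_comm, ← map_add, ← smul_add, ← mul_add, ← map_add] at this
        zero_mem' := by simp
        neg_mem' := fun {a} ha => by
          have := J.neg_mem ha
          rwa [neg_sub', ← map_neg, ← smul_neg, ← mul_neg, ← map_neg] at this }
    have hG : P • (1 : Symb k p) ∈ G := by
      refine symWt_induction G (fun q r f hr => ?_) (smul_one_mem_symWt P)
      change ofSymb ((pdOp i : DiffOp k p) • (monomial q (monomial r f) : Symb k p)) -
        pdOp i * ofSymb (monomial q (monomial r f)) ∈ J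
      rw [pdOp_smul_monomial, map_add, ofSymb_monomial, ofSymb_monomial, ofSymb_monomial,
        ← mul_assoc, pdOp_mul_mulHom, add_mul, add_comm (mulHom _ * pdOp i * _), add_sub_add_left_eq_sub,
        mul_assoc, ← mul_sub, ← neg_mem_iff, ← mul_neg, neg_sub]
      have := pd_mul_wtMon_sub_mem hJ i.2 (show r ≤ q * (k - 1) by omega)
      rw [pd_eq i.2] at this
      exact J.smul_mem (mulHom f) this
    have h := J.add_mem hG (J.smul_mem (pdOp i) hP)
    change ofSymb ((pdOp i * P) • (1 : Symb k p)) - pdOp i * P ∈ J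
    rwa [smul_eq_mul, mul_sub, sub_add_sub_cancel, ← mul_smul] at h

theorem mem_of_smul_one_eq_zero {J : Submodule (DiffOp k p) (DiffOp k p)} (hJ : opsA k p ⊆ J)
    {P : DiffOp k p} (h : P • (1 : Symb k p) = 0) : P ∈ J := by
  have := ofSymb_smul_one_sub_mem hJ P
  rwa [h, map_zero, zero_sub, neg_mem_iff] at this

theorem pd_smul_monomial_one {a : ℕ} (ha : a < k) (q r : ℕ) :
    pd k p (a + 1) • (monomial q (monomial r 1) : Symb k p) =
      monomial (q + 1) (monomial (r + a) 1) := by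
  have h : partialDeriv ⟨a, ha⟩ (1 : Hol k p) = 0 := (pdDer ⟨a, ha⟩).map_one_eq_zero
  rw [pd_eq ha, pdOp_smul_monomial, h]
  simp

theorem pd_smul_one {a : ℕ} (ha : a < k) :
    pd k p (a + 1) • (1 : Symb k p) = monomial 1 (monomial a 1) := by
  have := pd_smul_monomial_one (p := p) ha 0 0
  rwa [zero_add, zero_add] at this

theorem symb_opsA {P : DiffOp k p} (hP : P ∈ opsA k p) : P • (1 : Symb k p) = 0 := by
  obtain ⟨i, j, hi, hik, hj, hjk, rfl⟩ := hP
  obtain ⟨i, rfl⟩ := Nat.exists_eq_add_of_le' hi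
  obtain ⟨j, rfl⟩ := Nat.exists_eq_add_of_le' hj
  rw [sub_smul, mul_smul, mul_smul, show j + 2 - 1 = j + 1 from rfl, pd_smul_one (by omega),
    pd_smul_one (by omega), pd_smul_monomial_one (by omega), pd_smul_monomial_one (by omega),
    show j + 1 + i = j + (i + 1) by ring, sub_self]

theorem symb_opT (μ : ℂ) {m : ℕ} (hm : m + 2 ≤ k) :
    (pd k p 1 * pd k p (m + 1) + pd k p (m + 2) * Eop k p μ) • (1 : Symb k p) =
      symRel μ (monomial 1 (monomial m 1)) := by
  rw [add_smul, mul_smul, mul_smul, ← symEuler_one, ← map_smul, pd_smul_one (by omega),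
    pd_smul_one (by omega), pd_smul_monomial_one (a := 0) (by omega), symRel_apply, X_mul_monomial]
  congr 1
  have h : (monomial 1 (monomial (m + 1) 1) : Symb k p) = C X * monomial 1 (monomial m 1) := by
    rw [C_mul_monomial, X_mul_monomial]
  rw [h]
  simp only [symEuler_apply, derivative_mul, derivative_C]
  ring

/-- The symbols `s t^m`, `m ≤ k-2`, generate `symWt k p 0` over `D`. They are the arguments at which
`symRel μ` yields the generators `T^m_μ`. -/
theorem symWt_zero_le {T : Submodule (DiffOp k p) (Symb k p)}
    (hT : ∀ m, m + 2 ≤ k → (monomial 1 (monomial m 1) : Symb k p) ∈ T) : symWt k p 0 ≤ T := by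
  intro b hb
  have h1 : ∀ q r, r < q * (k - 1) → (monomial q (monomial r 1) : Symb k p) ∈ T := by
    intro q
    induction q with
    | zero => intro r hr; omega
    | succ q ih =>
      intro r hr
      rw [Nat.succ_mul] at hr
      rcases Nat.eq_zero_or_pos q with rfl | hq
      · exact hT r (by omega)
      · have hk : 1 ≤ k - 1 := by
          by_contra! h
          simp [show k - 1 = 0 by omega] at hr
        have hq' : 1 ≤ q * (k - 1) := Nat.mul_pos hq hk
        -- One derivative takes off as much weight as possible. If that is all of `r`, the remaining
        -- weight `0` is admissible because `q (k-1)` is positive.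
        have := T.smul_mem (pd k p (min r (k - 1) + 1)) (ih (r - min r (k - 1)) (by omega))
        rwa [pd_smul_monomial_one (by omega), show r - min r (k - 1) + min r (k - 1) = r by omega] at this
  refine symWt_induction T.toAddSubgroup (fun q r f hr => ?_) hb
  have := T.smul_mem (mulHom f) (h1 q r hr)
  rwa [mulHom_smul_monomial, mul_one] at this

/-- By `D`-linearity of `symRel μ` it suffices to look at generators: the `A_{i,j}` have symbol zero
and the `T^m_μ` come from `symb_opT`. -/
theorem exists_symRel_of_mem_idealI {μ : ℂ} {P : DiffOp k p} (hP : P ∈ idealI k p μ) :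
    ∃ u ∈ symWt k p 0, symRel μ u = P • (1 : Symb k p) := by
  have h : idealI k p μ ≤ ((symWt k p 0).map (symRel μ)).comap
      (LinearMap.toSpanSingleton (DiffOp k p) (Symb k p) 1) := by
    refine Submodule.span_le.2 ?_
    rintro P (hP | ⟨m, hm, hmk, rfl⟩)
    · change P • (1 : Symb k p) ∈ (symWt k p 0).map (symRel μ)
      rw [symb_opsA hP]
      exact ((symWt k p 0).map (symRel μ)).zero_mem
    · obtain ⟨m, rfl⟩ := Nat.exists_eq_add_of_le' hm
      refine ⟨monomial 1 (monomial m 1), fun q r h => ?_, (symb_opT μ hmk).symm⟩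
      rw [coeff_monomial]
      split_ifs with hq
      · subst hq
        rw [coeff_monomial, if_neg (by omega)]
      · rfl
  exact h hP

theorem mem_idealI_of_symRel {μ : ℂ} {P : DiffOp k p} {u : Symb k p} (hu : u ∈ symWt k p 0)
    (h : symRel μ u = P • (1 : Symb k p)) : P ∈ idealI k p μ := by
  have hle : symWt k p 0 ≤ ((idealI k p μ).map
      (LinearMap.toSpanSingleton (DiffOp k p) (Symb k p) 1)).comap (symRel μ) := by
    refine symWt_zero_le fun m hm => ?_
    exact ⟨_, Submodule.subset_span (Or.inr ⟨m + 2, by omega, hm, rfl⟩), symb_opT μ hm⟩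
  obtain ⟨P', hP', hPu⟩ := hle hu
  have h0 : (P - P') • (1 : Symb k p) = 0 := by
    rw [sub_smul, ← h, sub_eq_zero]
    exact hPu.symm
  have := mem_of_smul_one_eq_zero (J := idealI k p μ)
    (fun _ h => Submodule.subset_span (Or.inl h)) h0
  exact (Submodule.sub_mem_iff_left _ hP').1 this

theorem coeff_symEuler_succ (μ : ℂ) (b : Symb k p) (q : ℕ) :
    (symEuler μ b).coeff (q + 1) =
      symQ k p * b.coeff q + C (algebraMap ℂ (Hol k p) (μ + (q + 1))) * b.coeff (q + 1) := by
  rw [symEuler_apply, add_mul, mul_assoc, coeff_add, coeff_add, coeff_X_mul, coeff_C_mul,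
    coeff_C_mul, coeff_X_mul, coeff_derivative]
  simp only [map_add, map_natCast, map_one]
  ring

theorem coeff_symEuler_zero (μ : ℂ) (b : Symb k p) :
    (symEuler μ b).coeff 0 = C (algebraMap ℂ (Hol k p) μ) * b.coeff 0 := by
  rw [symEuler_apply, add_mul, mul_assoc, coeff_add, coeff_add, coeff_X_mul_zero, coeff_C_mul,
    coeff_X_mul_zero, zero_add, add_zero]

/-- `symQ` has degree at most `k-1` with coefficient `σ_k` in that degree, and `σ_k` is not a zero
divisor, so coefficients of `g` can be cancelled from the top down. -/
theorem coeff_eq_zero_of_symQ_mul (hk : 1 ≤ k) {g : (Hol k p)[X]} {m : ℕ}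
    (h : ∀ r, m + (k - 1) ≤ r → (symQ k p * g).coeff r = 0) : ∀ r, m ≤ r → g.coeff r = 0 := by
  suffices H : ∀ d r, g.natDegree < r + d → m ≤ r → g.coeff r = 0 from
    fun r hr => H (g.natDegree + 1) r (by omega) hr
  intro d
  induction d with
  | zero => intro r hr _; exact coeff_eq_zero_of_natDegree_lt (by omega)
  | succ d ih =>
    intro r hr hm
    have h1 := h (r + (k - 1)) (by omega)
    rw [coeff_mul, Finset.sum_eq_single (k - 1, r)] at h1
    · have h2 := coeff_symQ (p := p) ⟨k - 1, by omega⟩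
      simp only at h1 h2
      rw [h2] at h1
      exact eq_zero_of_co_mul_eq_zero _ _ h1
    · rintro ⟨a, b⟩ hab hne
      rw [Finset.HasAntidiagonal.mem_antidiagonal] at hab
      simp only at hab ⊢
      rcases lt_trichotomy a (k - 1) with ha | rfl | ha
      · rw [ih b (by omega) (by omega), mul_zero]
      · obtain rfl : b = r := by omega
        exact absurd rfl hne
      · rw [coeff_symQ_of_le (by omega), zero_mul]
    · intro h; exact absurd (Finset.HasAntidiagonal.mem_antidiagonal.2 (by omega)) h

/-- With `w = P • 1` and `u` in `symWt k p 0`, the hypothesis reads `symEuler μ (w - t u) = s u`. At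
`s = 0` this says `μ (w - t u)₀ = 0`, so `w - t u = s u'` since `μ ≠ 0`. Cancelling `s` gives `u =
symEuler (μ+1) u'`, hence `w = symRel (μ+1) u'`. -/
theorem mem_idealI_of_mul_Eop_mem (hk : 1 ≤ k) {μ : ℂ} (hμ : μ ≠ 0) {P : DiffOp k p}
    (hP : P * Eop k p μ ∈ idealI k p μ) : P ∈ idealI k p (μ + 1) := by
  obtain ⟨u, hu, h⟩ := exists_symRel_of_mem_idealI hP
  rw [← smul_symEuler_one, symRel_apply] at h
  have hCX : symEuler μ (C X * u) = C X * symEuler μ u := by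
    simp only [symEuler_apply, derivative_mul, derivative_C]
    ring
  set w := P • (1 : Symb k p) with hw
  have hv : symEuler μ (w - C X * u) = X * u := by
    rw [map_sub, hCX, ← h, add_sub_cancel_right]
  have hv0 : (w - C X * u).coeff 0 = 0 := by
    have h0 := congrArg (fun b => coeff b 0) hv
    simp only [coeff_symEuler_zero, coeff_X_mul_zero] at h0
    have hunit : IsUnit (C (algebraMap ℂ (Hol k p) μ)) :=
      ((isUnit_iff_ne_zero.2 hμ).map (algebraMap ℂ (Hol k p))).map C
    exact hunit.mul_right_eq_zero.1 h0
  obtain ⟨u', hu'⟩ := X_dvd_iff.2 hv0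
  rw [hu', symEuler_X_mul] at hv
  have hu2 : symEuler (μ + 1) u' = u := by
    ext1 q
    have := congrArg (fun b => coeff b (q + 1)) hv
    simpa only [coeff_X_mul] using this
  refine mem_idealI_of_symRel (u := u') ?_ ?_
  · have hw1 : w ∈ symWt k p 1 := smul_one_mem_symWt P
    -- Descending induction on the `s`-degree `q`: `symQ` times the `q`-th coefficient of `u'` is
    -- the next coefficient of `u` minus a constant times the next coefficient of `u'`.
    suffices H : ∀ d q, u'.natDegree < q + d → ∀ r, q * (k - 1) ≤ r → (u'.coeff q).coeff r = 0 from
      fun q r hr => H (u'.natDegree + 1) q (by omega) r hr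
    intro d
    induction d with
    | zero =>
      intro q hq r _
      rw [coeff_eq_zero_of_natDegree_lt (p := u') (by omega), coeff_zero]
    | succ d ih =>
      intro q hq
      refine coeff_eq_zero_of_symQ_mul hk fun r hr => ?_
      have h1 := coeff_symEuler_succ (μ + 1) u' q
      rw [hu2] at h1
      rw [← sub_eq_iff_eq_add.2 h1, coeff_sub, coeff_C_mul,
        hu (q + 1) r (by rw [Nat.succ_mul]; omega), ih (q + 1) (by omega) r (by rw [Nat.succ_mul]; omega),
        mul_zero, sub_zero]
  · rw [symRel_apply, hu2, ← hu', sub_add_cancel]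

end

/-! ### Derivations on localizations and on matrices -/

section LocDer

variable {A : Type*} [CommRing A] [Algebra ℂ A] (s : A) (K : Type*) [CommRing K] [Algebra A K]
  [Algebra ℂ K] [IsScalarTower ℂ A K] [IsLocalization.Away s K] (d : Derivation ℂ A A)

/-- The ring homomorphism `f ↦ f + ε d f` into the dual numbers over a localization. -/
def locDual : A →+* TrivSqZeroExt K K where
  toFun f := (algebraMap A K f, algebraMap A K (d f))
  map_one' := by
    rw [map_one, d.map_one_eq_zero, map_zero]
    rfl
  map_mul' f g := by
    rw [d.leibniz, map_mul, map_add, smul_eq_mul, smul_eq_mul, map_mul, map_mul,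
      mul_comm (algebraMap A K g)]
    rfl
  map_zero' := by
    rw [map_zero, map_zero, map_zero]
    rfl
  map_add' f g := by
    rw [map_add, map_add, map_add]
    rfl

omit [Algebra ℂ K] [IsScalarTower ℂ A K] in
theorem fst_locDual (f : A) : (locDual K d f).fst = algebraMap A K f := rfl

omit [Algebra ℂ K] [IsScalarTower ℂ A K] in
theorem snd_locDual (f : A) : (locDual K d f).snd = algebraMap A K (d f) := rfl

omit [Algebra ℂ K] [IsScalarTower ℂ A K] in
theorem isUnit_locDual : IsUnit (locDual K d s) := by
  rw [TrivSqZeroExt.isUnit_iff_isUnit_fst, fst_locDual]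
  exact IsLocalization.Away.algebraMap_isUnit s

/-- The extension of `locDual` to the localization. -/
def locDualLift : K →+* TrivSqZeroExt K K :=
  IsLocalization.Away.lift s (isUnit_locDual s K d)

omit [Algebra ℂ K] [IsScalarTower ℂ A K] in
theorem locDualLift_algebraMap (f : A) :
    locDualLift s K d (algebraMap A _ f) = locDual K d f := IsLocalization.Away.lift_eq _ _ _

omit [Algebra ℂ K] [IsScalarTower ℂ A K] in
theorem fst_locDualLift (x : K) : (locDualLift s K d x).fst = x := by
  have : ((TrivSqZeroExt.fstHom K K K).toRingHom).comp (locDualLift s K d) = RingHom.id _ := by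
    refine IsLocalization.ringHom_ext (Submonoid.powers s) (RingHom.ext fun f => ?_)
    change (locDualLift s K d (algebraMap A _ f)).fst = algebraMap A K f
    rw [locDualLift_algebraMap, fst_locDual]
  exact congrArg (fun F : K →+* K => F x) this

omit [Algebra ℂ K] [IsScalarTower ℂ A K] in
theorem snd_locDualLift_mul (x y : K) : (locDualLift s K d (x * y)).snd =
    x • (locDualLift s K d y).snd + y • (locDualLift s K d x).snd := by
  rw [map_mul, TrivSqZeroExt.snd_mul, fst_locDualLift, fst_locDualLift, op_smul_eq_smul]

/-- The extension of a derivation to a localization. -/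
def locDer : Derivation ℂ K K :=
  Derivation.mk'
    { toFun := fun x => (locDualLift s K d x).snd
      map_add' := fun x y => by rw [map_add, TrivSqZeroExt.snd_add]
      map_smul' := fun c x => by
        have h : ∀ y : K, c • y = algebraMap A K (algebraMap ℂ A c) * y := fun y => by
          rw [Algebra.smul_def, IsScalarTower.algebraMap_apply ℂ A K]
        rw [RingHom.id_apply, h, h, snd_locDualLift_mul, locDualLift_algebraMap, snd_locDual,
          d.map_algebraMap, map_zero, smul_zero, add_zero, smul_eq_mul] }
    (snd_locDualLift_mul s K d)

theorem locDer_algebraMap (f : A) :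
    locDer s K d (algebraMap A K f) = algebraMap A K (d f) := by
  change (locDualLift s K d (algebraMap A _ f)).snd = _
  rw [locDualLift_algebraMap, snd_locDual]

-- The commutator of the two extensions is a derivation vanishing on `A`, hence on the localization.
variable {d} in
theorem locDer_comm {e : Derivation ℂ A A} (h : ∀ f, d (e f) = e (d f)) (x : K) :
    locDer s K d (locDer s K e x) = locDer s K e (locDer s K d x) := by
  rw [← sub_eq_zero, ← Derivation.commutator_apply]
  obtain ⟨n, a, ha⟩ := IsLocalization.Away.surj s x
  set D : Derivation ℂ K K := ⁅locDer s K d, locDer s K e⁆ with hD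
  have h0 : ∀ f, D (algebraMap A K f) = 0 := fun f => by
    rw [hD, Derivation.commutator_apply, locDer_algebraMap, locDer_algebraMap, locDer_algebraMap,
      locDer_algebraMap, h, sub_self]
  have h1 := congrArg D ha
  rw [Derivation.leibniz, ← map_pow, h0, h0, smul_zero, zero_add, smul_eq_mul, map_pow] at h1
  exact ((IsLocalization.Away.algebraMap_isUnit s).pow n).mul_right_eq_zero.1 h1

end LocDer

section MatrixDer

variable {R : Type*} [CommRing R] [Algebra ℂ R] (d : Derivation ℂ R R) {n : Type*} [Fintype n]

theorem map_derivation_mul (A B : Matrix n n R) :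
    (A * B).map d = A.map d * B + A * B.map d := by
  ext i j
  simp only [Matrix.map_apply, Matrix.mul_apply, Matrix.add_apply, map_sum, Derivation.leibniz,
    smul_eq_mul, Finset.sum_add_distrib]
  rw [add_comm]
  simp [mul_comm]

theorem derivation_vecMul (v : n → R) (B : Matrix n n R) :
    (fun j => d (Matrix.vecMul v B j)) =
      Matrix.vecMul (fun j => d (v j)) B + Matrix.vecMul v (B.map d) := by
  ext j
  simp only [Matrix.map_apply, Matrix.vecMul, dotProduct, Pi.add_apply, map_sum,
    Derivation.leibniz, smul_eq_mul, Finset.sum_add_distrib]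
  rw [add_comm]
  simp [mul_comm]

theorem map_derivation_inv [DecidableEq n] {A : Matrix n n R} (hA : IsUnit A.det) :
    (A⁻¹).map d = -(A⁻¹ * A.map d * A⁻¹) := by
  have h := map_derivation_mul d A A⁻¹
  rw [Matrix.mul_nonsing_inv _ hA] at h
  have h1 : (1 : Matrix n n R).map d = 0 := by
    ext i j
    simp [Matrix.one_apply, apply_ite d]
  rw [h1] at h
  have h2 := congrArg (A⁻¹ * ·) h
  simp only [mul_zero, mul_add, ← mul_assoc, Matrix.nonsing_inv_mul _ hA, one_mul] at h2
  exact eq_neg_of_add_eq_zero_right h2.symm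

end MatrixDer

/-! ### Shift matrices and the flat connection on `V` -/

section Shift

variable (k : ℕ) (R : Type*) [CommRing R]

/-- The power `d` of the lower shift matrix. -/
def shiftMat (d : ℕ) : Matrix (Fin k) (Fin k) R :=
  Matrix.of fun a b => if (a : ℕ) = b + d then 1 else 0

theorem shiftMat_mul {d : ℕ} (B : Matrix (Fin k) (Fin k) R) (a : Fin k) :
    (shiftMat k R d * B) a =
      if d ≤ (a : ℕ) then B ⟨a - d, (Nat.sub_le _ _).trans_lt a.2⟩ else 0 := by
  ext b
  simp only [Matrix.mul_apply, shiftMat, Matrix.of_apply, ite_mul, one_mul, zero_mul]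
  split_ifs with h
  · rw [Finset.sum_eq_single ⟨a - d, (Nat.sub_le _ _).trans_lt a.2⟩]
    · rw [if_pos]
      simp only
      omega
    · intro c _ hc
      rw [if_neg]
      intro hac
      exact hc (Fin.ext (by simp only; omega))
    · simp
  · exact Finset.sum_eq_zero fun c _ => if_neg (by omega)

theorem shiftMat_mul_shiftMat (d e : ℕ) :
    shiftMat k R d * shiftMat k R e = shiftMat k R (d + e) := by
  ext a b
  rw [shiftMat_mul]
  split_ifs with h
  · simp only [shiftMat, Matrix.of_apply]
    exact if_congr (by omega) rfl rfl
  · simp only [shiftMat, Matrix.of_apply]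
    rw [if_neg (by omega)]
    rfl

theorem shiftMat_commute (d e : ℕ) : Commute (shiftMat k R d) (shiftMat k R e) := by
  rw [Commute, SemiconjBy, shiftMat_mul_shiftMat, shiftMat_mul_shiftMat, add_comm]

end Shift

/-- The coordinate functions in `𝒪_{N,p}[σ_k⁻¹]`. -/
def lco (p : Fin k → ℂ) (i : Fin k) : HolLoc k p := algebraMap (Hol k p) _ (co k p i)

/-- As a polynomial in the shift matrix, `M` commutes with all shifts, and its derivatives are
shifts. -/
theorem matM_eq : matM k p = ∑ i : Fin k, lco p i • shiftMat k (HolLoc k p) (k - 1 - i) := by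
  ext a b
  simp only [matM, Matrix.of_apply, Matrix.sum_apply, Matrix.smul_apply, shiftMat, smul_eq_mul,
    mul_ite, mul_one, mul_zero]
  split_ifs with h
  · have hab : (b : ℕ) ≤ a := h
    rw [Finset.sum_eq_single ⟨k - 1 - (a - b), by omega⟩]
    · rw [if_pos (by simp only; omega), lco, co]
      congr 2
      simp only
      omega
    · intro c _ hc
      rw [if_neg]
      intro hac
      exact hc (Fin.ext (by simp only; omega))
    · simp
  · have hab : ¬ (b : ℕ) ≤ a := h
    exact (Finset.sum_eq_zero fun c _ => if_neg (by omega)).symm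

theorem isUnit_sig : IsUnit (algebraMap (Hol k p) (HolLoc k p) (sig k p k)) :=
  IsLocalization.Away.algebraMap_isUnit _

theorem isUnit_det_matM : IsUnit (matM k p).det := by
  rw [Matrix.det_of_isLowerTriangular]
  · simp only [matM, Matrix.of_apply, le_refl, if_true, Nat.sub_self, Nat.sub_zero]
    rw [Finset.prod_const]
    exact isUnit_sig.pow _
  · intro a b hab
    exact if_neg (not_le.2 hab)

theorem shiftMat_commute_matM (d : ℕ) : Commute (shiftMat k (HolLoc k p) d) (matM k p) := by
  rw [matM_eq]
  exact Commute.sum_right _ _ _ fun i _ => (shiftMat_commute _ _ _ _).smul_right _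

theorem shiftMat_commute_inv (d : ℕ) : Commute (shiftMat k (HolLoc k p) d) (matM k p)⁻¹ := by
  have hu := isUnit_det_matM (k := k) (p := p)
  have h := congrArg (fun A => (matM k p)⁻¹ * A * (matM k p)⁻¹) (shiftMat_commute_matM (p := p) d).eq
  simp only [mul_assoc, Matrix.mul_nonsing_inv _ hu, mul_one] at h
  rw [← mul_assoc (matM k p)⁻¹ (matM k p), Matrix.nonsing_inv_mul _ hu, one_mul] at h
  exact h.symm

/-- The extension of `∂_{i+1}` to `𝒪_{N,p}[σ_k⁻¹]`. -/
def locPd (i : Fin k) : Derivation ℂ (HolLoc k p) (HolLoc k p) :=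
  locDer (sig k p k) _ (pdDer i)

theorem locPd_algebraMap (i : Fin k) (f : Hol k p) :
    locPd i (algebraMap _ (HolLoc k p) f) = algebraMap _ _ (partialDeriv i f) :=
  locDer_algebraMap _ _ _ f

theorem locPd_comm (i j : Fin k) (x : HolLoc k p) : locPd i (locPd j x) = locPd j (locPd i x) :=
  locDer_comm _ _ (partialDeriv_comm i j) x

theorem matM_map_locPd (i : Fin k) :
    (matM k p).map (locPd i) = shiftMat k (HolLoc k p) (k - 1 - i) := by
  have h : ∀ (j : Fin k) (a b : Fin k), locPd i ((lco p j • shiftMat k (HolLoc k p) (k - 1 - j)) a b) =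
      if i = j then shiftMat k (HolLoc k p) (k - 1 - j) a b else 0 := by
    intro j a b
    rw [Matrix.smul_apply, smul_eq_mul, Derivation.leibniz, lco, locPd_algebraMap, partialDeriv_co]
    have : locPd i (shiftMat k (HolLoc k p) (k - 1 - j) a b) = 0 := by
      simp [shiftMat, apply_ite (locPd i)]
    rw [this]
    split_ifs <;> simp
  ext a b
  rw [Matrix.map_apply, matM_eq, Matrix.sum_apply, map_sum, Finset.sum_congr rfl fun j _ => h j a b]
  simp

/-- The matrices of the connection, up to the factor `-(μ+1)`. -/
def connMat (i : Fin k) : Matrix (Fin k) (Fin k) (HolLoc k p) :=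
  shiftMat k (HolLoc k p) (k - 1 - i) * (matM k p)⁻¹

theorem connMat_commute (i j : Fin k) : Commute (connMat (p := p) i) (connMat j) :=
  ((shiftMat_commute _ _ _ _).mul_right (shiftMat_commute_inv _)).mul_left
    ((shiftMat_commute_inv _).symm.mul_right (Commute.refl _))

/-- From `d(M⁻¹) = -M⁻¹ dM M⁻¹`, where `dM` in direction `i` is the shift entering `connMat i`. The
result is symmetric in `i` and `j`, which is the source of flatness. -/
theorem connMat_map (i j : Fin k) :
    (connMat (p := p) j).map (locPd i) = -(connMat i * connMat j) := by
  have h : (shiftMat k (HolLoc k p) (k - 1 - j)).map (locPd i) = 0 := by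
    ext a b
    simp [shiftMat, apply_ite (locPd i)]
  rw [(connMat_commute i j).eq, connMat, map_derivation_mul, h, zero_mul, zero_add, map_derivation_inv _ isUnit_det_matM,
    matM_map_locPd, mul_neg]
  simp only [connMat, mul_assoc]

/-- The number `μ + 1` in `𝒪_{N,p}[σ_k⁻¹]`. -/
def connConst (k : ℕ) (p : Fin k → ℂ) (μ : ℂ) : HolLoc k p :=
  algebraMap (Hol k p) (HolLoc k p) (algebraMap ℂ (Hol k p) (μ + 1))

theorem locPd_connConst (i : Fin k) (μ : ℂ) : locPd i (connConst k p μ) = 0 := by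
  rw [connConst, locPd_algebraMap, ← pdDer_apply, Derivation.map_algebraMap, map_zero]

/-- The connection on row vectors. -/
def conn (μ : ℂ) (i : Fin k) : AddMonoid.End (Fin k → HolLoc k p) :=
  AddMonoidHom.mk' (fun v => (fun j => locPd i (v j)) - connConst k p μ • Matrix.vecMul v (connMat i))
    fun v w => by
      ext j
      simp [Matrix.add_vecMul]
      ring

theorem conn_apply (μ : ℂ) (i : Fin k) (v : Fin k → HolLoc k p) :
    conn μ i v = (fun j => locPd i (v j)) - connConst k p μ • Matrix.vecMul v (connMat i) := rfl

theorem conn_commute (μ : ℂ) (i j : Fin k) : Commute (conn (p := p) μ i) (conn μ j) := by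
  refine AddMonoidHom.ext fun v => ?_
  change conn μ i (conn μ j v) = conn μ j (conn μ i v)
  -- Each term of this expansion is symmetric in `i` and `j`.
  have key : ∀ i j : Fin k, conn (p := p) μ i (conn μ j v) = (fun a => locPd i (locPd j (v a))) -
      connConst k p μ • (Matrix.vecMul (fun a => locPd i (v a)) (connMat j) +
        Matrix.vecMul (fun a => locPd j (v a)) (connMat i)) +
      (connConst k p μ + connConst k p μ ^ 2) • Matrix.vecMul v (connMat i * connMat j) := by
    intro i j
    have h1 : (fun a => locPd i (conn μ j v a)) = (fun a => locPd i (locPd j (v a))) -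
        connConst k p μ • (fun a => locPd i (Matrix.vecMul v (connMat j) a)) := by
      ext a
      simp [conn_apply, Derivation.leibniz, locPd_connConst]
    rw [conn_apply, h1, derivation_vecMul, connMat_map, conn_apply, Matrix.sub_vecMul,
      Matrix.smul_vecMul, Matrix.vecMul_vecMul, Matrix.vecMul_neg, (connMat_commute j i).eq]
    ext a
    simp only [Pi.add_apply, Pi.sub_apply, Pi.smul_apply, Pi.neg_apply, smul_eq_mul]
    ring
  rw [key i j, key j i, (connMat_commute j i).eq, add_comm (Matrix.vecMul _ (connMat i))]
  simp only [locPd_comm i j]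

/-- Functions act on row vectors. -/
def connFun (k : ℕ) (p : Fin k → ℂ) : Hol k p →+* AddMonoid.End (Fin k → HolLoc k p) :=
  (Module.toAddMonoidEnd (HolLoc k p) (Fin k → HolLoc k p)).comp (algebraMap _ _)

theorem connFun_apply (f : Hol k p) (v : Fin k → HolLoc k p) :
    connFun k p f v = algebraMap (Hol k p) (HolLoc k p) f • v := rfl

theorem conn_leibniz (μ : ℂ) (i : Fin k) (f : Hol k p) :
    conn μ i * connFun k p f = connFun k p f * conn μ i + connFun k p (partialDeriv i f) := by
  refine AddMonoidHom.ext fun v => ?_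
  change conn μ i (connFun k p f v) = connFun k p f (conn μ i v) + connFun k p (partialDeriv i f) v
  rw [connFun_apply, connFun_apply, connFun_apply, conn_apply, conn_apply, Matrix.smul_vecMul]
  ext a
  simp only [Pi.sub_apply, Pi.add_apply, Pi.smul_apply, smul_eq_mul, Derivation.leibniz,
    locPd_algebraMap]
  ring

/-- The connection as a module structure over `D_{N,p}`. -/
abbrev connModule (k : ℕ) (p : Fin k → ℂ) (μ : ℂ) : Module (DiffOp k p) (FreeLoc k p) :=
  Module.compHom (Fin k → HolLoc k p)
    (extHom (connFun k p) (conn μ) (conn_commute μ) (conn_leibniz μ))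

theorem connModule_mulHom (μ : ℂ) (f : Hol k p) (v : FreeLoc k p) :
    letI := connModule k p μ
    mulHom f • v = algebraMap (Hol k p) (HolLoc k p) f • v :=
  congrArg (fun F : AddMonoid.End (Fin k → HolLoc k p) => F v)
    (extHom_mulHom (connFun k p) (conn μ) (conn_commute μ) (conn_leibniz μ) f)

theorem connModule_pdOp (μ : ℂ) (i : Fin k) (v : FreeLoc k p) :
    letI := connModule k p μ
    (pdOp i : DiffOp k p) • v = conn μ i v :=
  congrArg (fun F : AddMonoid.End (Fin k → HolLoc k p) => F v)
    (extHom_pdOp (connFun k p) (conn μ) (conn_commute μ) (conn_leibniz μ) i)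

theorem stdVec_eq (a : Fin k) :
    stdVec k p (a + 1) = (Pi.single a 1 : Fin k → HolLoc k p) := by
  funext j
  simp [stdVec, Pi.single_apply, Fin.ext_iff]

theorem conn_stdVec (μ : ℂ) (i a : Fin k) :
    conn (p := p) μ i (stdVec k p (a + 1)) = -(connConst k p μ • connMat i a) := by
  rw [stdVec_eq, conn_apply, Matrix.single_one_vecMul]
  ext j
  simp [Pi.single_apply, apply_ite (locPd i), Matrix.row]

/-- The rows of the inverse of `M`, numbered by natural numbers. -/
def invRow (k : ℕ) (p : Fin k → ℂ) (a : ℕ) : Fin k → HolLoc k p :=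
  if h : a < k then (matM k p)⁻¹ ⟨a, h⟩ else 0

theorem connMat_apply (i a : Fin k) : connMat (p := p) i a =
    if k - 1 - i ≤ (a : ℕ) then invRow k p (a - (k - 1 - i)) else 0 := by
  rw [connMat, shiftMat_mul, invRow, dif_pos ((Nat.sub_le _ _).trans_lt a.2)]

theorem sum_smul_stdVec (v : Fin k → HolLoc k p) :
    ∑ j : Fin k, v j • stdVec k p (j + 1) = (v : FreeLoc k p) := by
  have h : ∑ j : Fin k, v j • (Pi.single j 1 : Fin k → HolLoc k p) = v := by
    ext a
    simp [Finset.sum_apply, Pi.single_apply]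
  simp only [stdVec_eq]
  exact h

theorem isConnectionAction_connModule (hk : 1 ≤ k) (μ : ℂ) :
    IsConnectionAction k p μ (connModule k p μ) := by
  let := connModule k p μ
  have hpd : ∀ a q, a < k → q < k → pd k p (a + 1) • stdVec k p (q + 1) =
      (if k - 1 ≤ q + a then -(connConst k p μ • invRow k p (q + a - (k - 1))) else 0 :
        Fin k → HolLoc k p) := by
    intro a q ha hq
    rw [pd_eq ha]
    refine (connModule_pdOp μ ⟨a, ha⟩ _).trans ((conn_stdVec μ ⟨a, ha⟩ ⟨q, hq⟩).trans ?_)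
    rw [connMat_apply]
    by_cases h : k - 1 ≤ q + a
    · rw [if_pos (by simp only; omega), if_pos h,
        show q + a - (k - 1) = q - (k - 1 - a) by omega]
    · rw [if_neg (by simp only; omega), if_neg h, smul_zero, neg_zero]
  refine ⟨connModule_mulHom μ, fun i => ?_, fun a q h ha hak hq hqk hh hhk heq => ?_,
    fun a q ha hq hle => ?_⟩
  · have h1 := hpd (k - 1) i (by omega) i.2
    rw [show k - 1 + 1 = k by omega] at h1
    rw [h1, if_pos (by omega), sum_smul_stdVec, show (i : ℕ) + (k - 1) - (k - 1) = i by omega,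
      invRow, dif_pos i.2]
    exact (neg_smul _ _).symm
  · obtain ⟨a, rfl⟩ := Nat.exists_eq_add_of_le' ha
    obtain ⟨q, rfl⟩ := Nat.exists_eq_add_of_le' hq
    obtain ⟨h, rfl⟩ := Nat.exists_eq_add_of_le' hh
    have h1 := hpd (k - 1) h (by omega) (by omega)
    rw [show k - 1 + 1 = k by omega] at h1
    rw [h1, hpd a q (by omega) (by omega), show q + a = h + (k - 1) by omega]
  · obtain ⟨a, rfl⟩ := Nat.exists_eq_add_of_le' ha
    obtain ⟨q, rfl⟩ := Nat.exists_eq_add_of_le' hq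
    rw [hpd a q (by omega) (by omega), if_neg (by omega)]
    rfl

/-! ### Homogeneity, and modules generated by a vector killed by `L_μ` -/

theorem pd_mul_Eop (μ : ℂ) (a : ℕ) :
    pd k p a * Eop k p μ = Eop k p (μ + 1) * pd k p a := by
  by_cases h : 1 ≤ a ∧ a ≤ k
  · obtain ⟨a, rfl⟩ := Nat.exists_eq_add_of_le' h.1
    have ha : a < k := h.2
    have hsum : ∀ i : Fin k, pdOp ⟨a, ha⟩ * (mulHom (co k p i) * pdOp i) =
        mulHom (co k p i) * pdOp i * pdOp ⟨a, ha⟩ + if (⟨a, ha⟩ : Fin k) = i then pdOp i else 0 := by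
      intro i
      rw [← mul_assoc, pdOp_mul_mulHom, partialDeriv_co, add_mul, mul_assoc, mul_assoc,
        (pdOp_comm i _).eq]
      split_ifs <;> simp
    have hμ : partialDeriv ⟨a, ha⟩ (algebraMap ℂ (Hol k p) μ) = 0 :=
      (pdDer (p := p) ⟨a, ha⟩).map_algebraMap μ
    rw [pd_eq ha, Eop_eq, Eop_eq, mul_add, Finset.mul_sum, Finset.sum_congr rfl fun i _ => hsum i,
      Finset.sum_add_distrib, Finset.sum_ite_eq, if_pos (Finset.mem_univ _), pdOp_mul_mulHom, hμ,
      map_add, map_one, map_add, map_one, map_zero, add_zero, add_mul, Finset.sum_mul, add_mul,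
      one_mul]
    abel
  · rw [pd, dif_neg h, zero_mul, mul_zero]

theorem idealI_le_idealL (μ : ℂ) : idealI k p μ ≤ idealL k p μ := by
  refine Submodule.span_le.2 ?_
  rintro P (hP | ⟨m, hm, hmk, rfl⟩)
  · exact Submodule.subset_span (Or.inl (Or.inl hP))
  · exact Submodule.add_mem _
      (Submodule.subset_span (Or.inl (Or.inr ⟨m - 1, by omega, by omega, rfl⟩)))
      (Submodule.smul_mem _ _ (Submodule.subset_span (Or.inr rfl)))

/-- The additive subgroup of `𝒪`-linear combinations of a family is the range of this map. -/
def combo (p : Fin k → ℂ) {X : Type*} [AddCommGroup X] [Module (DiffOp k p) X] (y : Fin k → X) :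
    (Fin k → Hol k p) →+ X :=
  AddMonoidHom.mk' (fun f => ∑ j, mulHom (f j) • y j) fun f g => by
    simp [add_smul, Finset.sum_add_distrib]

theorem combo_apply {X : Type*} [AddCommGroup X] [Module (DiffOp k p) X] (y : Fin k → X)
    (f : Fin k → Hol k p) : combo p y f = ∑ j, mulHom (f j) • y j := rfl

theorem smul_mem_combo {X : Type*} [AddCommGroup X] [Module (DiffOp k p) X] (y : Fin k → X)
    (g : Hol k p) {x : X} (hx : x ∈ (combo p y).range) : mulHom g • x ∈ (combo p y).range := by
  obtain ⟨f, rfl⟩ := hx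
  refine ⟨fun j => g * f j, ?_⟩
  simp [combo_apply, Finset.smul_sum, mul_smul]

theorem mem_combo {X : Type*} [AddCommGroup X] [Module (DiffOp k p) X] (y : Fin k → X)
    (j : Fin k) : y j ∈ (combo p y).range := by
  refine ⟨Pi.single j 1, ?_⟩
  rw [combo_apply, Finset.sum_eq_single j]
  · simp
  · intro i _ hi
    simp [Pi.single_eq_of_ne hi]
  · simp

theorem combo_le {X : Type*} [AddCommGroup X] [Module (DiffOp k p) X] {y : Fin k → X}
    {T : AddSubgroup X} (hT : ∀ f : Hol k p, ∀ x ∈ T, mulHom f • x ∈ T) (hy : ∀ j, y j ∈ T) :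
    (combo p y).range ≤ T := by
  rintro _ ⟨f, rfl⟩
  rw [combo_apply]
  exact sum_mem fun j _ => hT _ _ (hy j)

theorem mem_of_const_smul_mem {X : Type*} [AddCommGroup X] [Module (DiffOp k p) X] {T : AddSubgroup X}
    (hT : ∀ f : Hol k p, ∀ x ∈ T, mulHom f • x ∈ T) {c : ℂ} (hc : c ≠ 0) {x : X}
    (h : mulHom (algebraMap ℂ (Hol k p) c) • x ∈ T) : x ∈ T := by
  have h3 := hT (algebraMap ℂ (Hol k p) c⁻¹) _ h
  rwa [smul_smul, ← map_mul, ← map_mul, inv_mul_cancel₀ hc, map_one, map_one, one_smul] at h3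

theorem co_last (hk : 1 ≤ k) : co k p ⟨k - 1, by omega⟩ = sig k p k := by
  rw [co]
  congr 1
  simp only
  omega

section Cyclic

/-- The derivatives `∂_k^q ∂_{j+1} u` of an element `u`. -/
def zvec (p : Fin k → ℂ) {X : Type*} [AddCommGroup X] [Module (DiffOp k p) X] (u : X) (q : ℕ) (j : Fin k) : X := (pd k p k ^ q * pd k p (j + 1)) • u

variable {X : Type*} [AddCommGroup X] [Module (DiffOp k p) X] {u : X} {μ : ℂ} (hu : ∀ P ∈ idealL k p μ, P • u = 0)

include hu

/-- Modulo the `A_{i,j}` only the weight `i + j` counts. If it reaches `k-1`, one factor becomes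
`∂_k`; otherwise one factor becomes `∂_1`, and the product is a generator of `L_μ`. -/
theorem pd_mul_pd_smul (hk : 1 ≤ k) (i j : Fin k) : (pd k p (i + 1) * pd k p (j + 1)) • u =
    if k - 1 ≤ (j : ℕ) + i then (pd k p k * pd k p (j + i - (k - 1) + 1)) • u else 0 := by
  have hA : opsA k p ⊆ idealL k p μ := fun P hP => Submodule.subset_span (Or.inl (Or.inl hP))
  split_ifs with h
  · have h1 := hu _ (pd_mul_pd_sub_mem hA i.2 j.2 (a' := k - 1) (b' := j + i - (k - 1))
      (by omega) (by omega) (by omega))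
    rwa [sub_smul, sub_eq_zero, show k - 1 + 1 = k by omega] at h1
  · have h1 := hu _ (pd_mul_pd_sub_mem hA i.2 j.2 (a' := 0) (b' := j + i)
      (by omega) (by omega) (by omega))
    rw [sub_smul, sub_eq_zero] at h1
    rw [h1]
    exact hu _ (Submodule.subset_span (Or.inl (Or.inr ⟨j + i + 1, by omega, by omega, rfl⟩)))

theorem pdOp_smul_zvec (hk : 1 ≤ k) (q : ℕ) (i j : Fin k) :
    (pdOp i : DiffOp k p) • zvec p u q j =
      if h : k - 1 ≤ (j : ℕ) + i then zvec p u (q + 1) ⟨j + i - (k - 1), by omega⟩ else 0 := by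
  have hc : Commute (pd k p (i + 1)) (pd k p k ^ q) := (pd_comm _ _).pow_right q
  rw [← pd_eq i.2, zvec, smul_smul, ← mul_assoc, hc.eq, mul_assoc, mul_smul, pd_mul_pd_smul hu hk]
  split_ifs with h
  · rw [zvec, smul_smul, ← mul_assoc, pow_succ]
  · rw [smul_zero]

theorem Eop_smul_zvec (q : ℕ) (j : Fin k) : Eop k p (μ + (q + 1)) • zvec p u q j = 0 := by
  have h : ∀ (q : ℕ), pd k p k ^ q * Eop k p (μ + 1) = Eop k p (μ + (q + 1)) * pd k p k ^ q := by
    intro q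
    induction q with
    | zero => simp
    | succ q ih =>
      rw [pow_succ', mul_assoc, ih, ← mul_assoc, pd_mul_Eop, mul_assoc]
      congr 2
      push_cast
      ring
  rw [zvec, smul_smul, ← mul_assoc, ← h, mul_assoc, ← pd_mul_Eop, ← mul_assoc, mul_smul,
    hu _ (Submodule.subset_span (Or.inr rfl)), smul_zero]

/-- The relations among the derivatives of `u` are triangular. -/
theorem zvec_triangular (hk : 1 ≤ k) {T : AddSubgroup X}
    (hT : ∀ f : Hol k p, ∀ x ∈ T, mulHom f • x ∈ T) {q : ℕ} {j : Fin k}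
    (h : ∀ j' < j, zvec p u (q + 1) j' ∈ T) :
    mulHom (sig k p k) • zvec p u (q + 1) j +
      mulHom (algebraMap ℂ (Hol k p) (μ + (q + 1))) • zvec p u q j ∈ T := by
  have h1 := Eop_smul_zvec hu q j
  -- In the Euler relation for `z_{q,j}` the summand with index `k-1` is `σ_k z_{q+1,j}`; any other
  -- index `i` gives zero or `z_{q+1,j+i-(k-1)}`, whose second index is smaller than `j`.
  rw [Eop_eq, add_smul, Finset.sum_smul,
    ← Finset.add_sum_erase _ _ (Finset.mem_univ (⟨k - 1, by omega⟩ : Fin k)), mul_smul,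
    pdOp_smul_zvec hu hk, dif_pos (by simp), co_last hk] at h1
  have h2 : (⟨(j : ℕ) + (k - 1) - (k - 1), by omega⟩ : Fin k) = j := Fin.ext (by simp)
  simp only [h2] at h1
  rw [add_right_comm, add_eq_zero_iff_eq_neg] at h1
  rw [h1]
  refine neg_mem (sum_mem fun i hi => ?_)
  have hi' : (i : ℕ) ≠ k - 1 := fun hh => (Finset.mem_erase.1 hi).1 (Fin.ext hh)
  rw [mul_smul, pdOp_smul_zvec hu hk]
  refine hT _ _ ?_
  split_ifs with hij
  · refine h _ ?_
    rw [Fin.lt_def]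
    simp only
    omega
  · exact T.zero_mem

theorem mem_combo_zvec_zero (hμ : μ ≠ 0) : u ∈ (combo p (zvec p u 0)).range := by
  have h1 := hu (Eop k p μ) (Submodule.subset_span (Or.inr rfl))
  rw [Eop_eq, add_smul, Finset.sum_smul, add_eq_zero_iff_eq_neg'] at h1
  have h2 : mulHom (algebraMap ℂ (Hol k p) μ) • u ∈ (combo p (zvec p u 0)).range := by
    rw [h1]
    refine neg_mem (sum_mem fun i _ => ?_)
    rw [mul_smul]
    refine smul_mem_combo _ _ ?_
    have := mem_combo (p := p) (zvec p u 0) i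
    rwa [zvec, pow_zero, one_mul, pd_eq i.2] at this
  have h3 := smul_mem_combo (zvec p u 0) (algebraMap ℂ (Hol k p) μ⁻¹) h2
  rwa [smul_smul, ← map_mul, ← map_mul, inv_mul_cancel₀ hμ, map_one, map_one, one_smul] at h3

/-- The set `T` of elements brought into the span by a power of `σ_k` is closed under division by
`σ_k`. The triangular relations at `q = 0` put the `z_{1,j}` in `T`, and then the Leibniz rule makes
`T` stable under derivations. The hypothesis `μ ≠ 0` serves to place `u` in `T`. -/
theorem exists_pow_smul_mem_combo (hk : 1 ≤ k) (hμ : μ ≠ 0) (P : DiffOp k p) :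
    ∃ n : ℕ, mulHom (sig k p k ^ n) • P • u ∈ (combo p (zvec p u 0)).range := by
  set Y := (combo p (zvec p u 0)).range with hY
  let T : AddSubgroup X :=
    { carrier := {x | ∃ n : ℕ, mulHom (sig k p k ^ n) • x ∈ Y}
      add_mem' := by
        rintro a b ⟨n, hn⟩ ⟨m, hm⟩
        refine ⟨n + m, ?_⟩
        rw [smul_add, pow_add, map_mul]
        refine add_mem ?_ ?_
        · rw [← map_mul, mul_comm, map_mul, mul_smul]
          exact smul_mem_combo _ _ hn
        · rw [mul_smul]
          exact smul_mem_combo _ _ hm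
      zero_mem' := ⟨0, by simp⟩
      neg_mem' := by
        rintro a ⟨n, hn⟩
        exact ⟨n, by rw [smul_neg]; exact neg_mem hn⟩ }
  have hYT : ∀ x ∈ Y, x ∈ T := fun x hx => ⟨0, by simpa using hx⟩
  have hT : ∀ f : Hol k p, ∀ x ∈ T, mulHom f • x ∈ T := by
    rintro f x ⟨n, hn⟩
    refine ⟨n, ?_⟩
    rw [smul_smul, ← map_mul, mul_comm, map_mul, mul_smul]
    exact smul_mem_combo _ _ hn
  have hdiv : ∀ x, mulHom (sig k p k) • x ∈ T → x ∈ T := by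
    rintro x ⟨n, hn⟩
    exact ⟨n + 1, by rwa [pow_succ, map_mul, mul_smul]⟩
  have hz0 : ∀ j, zvec p u 0 j ∈ T := fun j => hYT _ (mem_combo _ j)
  have hz1 : ∀ j, zvec p u 1 j ∈ T := by
    intro j
    induction j using WellFoundedLT.induction with
    | ind j ih =>
      have := zvec_triangular hu hk hT (q := 0) ih
      exact hdiv _ ((add_mem_cancel_right (hT _ _ (hz0 j))).1 this)
  have hpd : ∀ (i : Fin k), ∀ x ∈ T, (pdOp i : DiffOp k p) • x ∈ T := by
    rintro i x ⟨n, hn⟩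
    induction n generalizing x with
    | zero =>
      rw [pow_zero, map_one, one_smul] at hn
      obtain ⟨f, rfl⟩ := hn
      rw [combo_apply, Finset.smul_sum]
      refine sum_mem fun j _ => ?_
      rw [pdOp_smul_mulHom_smul, pdOp_smul_zvec hu hk]
      refine add_mem (hT _ _ ?_) (hT _ _ (hz0 j))
      split_ifs
      · exact hz1 _
      · exact T.zero_mem
    | succ n ih =>
      have hx : x ∈ T := ⟨n + 1, hn⟩
      rw [pow_succ, map_mul, mul_smul] at hn
      have h1 := ih _ hn
      rw [pdOp_smul_mulHom_smul] at h1
      exact hdiv _ ((add_mem_cancel_right (hT _ _ hx)).1 h1)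
  exact smul_mem_of_stable T hT hpd P u (hYT _ (mem_combo_zvec_zero hu hμ))

/-- The triangular relation is solved for its `z_{q,j}` term, without dividing by `σ_k`; thus the
spans increase with `q`. -/
theorem zvec_mem_combo_succ (hk : 1 ≤ k) {q : ℕ} (hq : μ + (q + 1) ≠ 0) (j : Fin k) :
    zvec p u q j ∈ (combo p (zvec p u (q + 1))).range := by
  have hT := fun (f : Hol k p) x => smul_mem_combo (zvec p u (q + 1)) f (x := x)
  have := zvec_triangular hu hk hT (q := q) (j := j) fun j' _ => mem_combo _ j'
  exact mem_of_const_smul_mem hT hq ((add_mem_cancel_left (hT _ _ (mem_combo _ j))).1 this)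

theorem exists_eq_combo (hk : 1 ≤ k) (hμ : ∀ n : ℕ, μ ≠ -(n : ℂ)) (P : DiffOp k p) :
    ∃ q, P • u ∈ (combo p (zvec p u q)).range := by
  have hq : ∀ q : ℕ, μ + (q + 1) ≠ 0 := fun q h => hμ (q + 1) (by push_cast; linear_combination h)
  have hmono : Monotone fun q => (combo p (zvec p u q)).range :=
    monotone_nat_of_le_succ fun q =>
      combo_le (fun f x => smul_mem_combo _ f) (zvec_mem_combo_succ hu hk (hq q))
  let T : AddSubgroup X :=
    { carrier := {x | ∃ q, x ∈ (combo p (zvec p u q)).range}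
      add_mem' := by
        rintro a b ⟨n, hn⟩ ⟨m, hm⟩
        exact ⟨max n m, add_mem (hmono (le_max_left _ _) hn) (hmono (le_max_right _ _) hm)⟩
      zero_mem' := ⟨0, zero_mem _⟩
      neg_mem' := by
        rintro a ⟨n, hn⟩
        exact ⟨n, neg_mem hn⟩ }
  refine smul_mem_of_stable T ?_ ?_ P u ⟨0, mem_combo_zvec_zero hu fun h => hμ 0 (by simpa using h)⟩
  · rintro f x ⟨q, hx⟩
    exact ⟨q, smul_mem_combo _ _ hx⟩
  · rintro i x ⟨q, f, rfl⟩
    rw [combo_apply, Finset.smul_sum]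
    refine sum_mem fun j _ => ?_
    rw [pdOp_smul_mulHom_smul, pdOp_smul_zvec hu hk]
    refine add_mem ⟨q + 1, smul_mem_combo _ _ ?_⟩ ⟨q, smul_mem_combo _ _ (mem_combo _ j)⟩
    split_ifs
    · exact mem_combo _ _
    · exact zero_mem _

/-- Modulo `σ_k X`, the triangular relation expresses `z_{q,j}` through the `z_{q+1,j'}` with `j' <
j`. Induction on `j`, for all `q` at once, puts every `z_{q,j}` in `σ_k X`. -/
theorem exists_sig_smul_eq (hk : 1 ≤ k) (hμ : ∀ n : ℕ, μ ≠ -(n : ℂ)) (P : DiffOp k p) :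
    ∃ y : X, mulHom (sig k p k) • y = P • u := by
  have hq : ∀ q : ℕ, μ + (q + 1) ≠ 0 := fun q h => hμ (q + 1) (by push_cast; linear_combination h)
  let T : AddSubgroup X := (DistribSMul.toAddMonoidHom X (mulHom (sig k p k))).range
  have hT : ∀ f : Hol k p, ∀ x ∈ T, mulHom f • x ∈ T := by
    rintro f _ ⟨x, rfl⟩
    refine ⟨mulHom f • x, ?_⟩
    change mulHom (sig k p k) • mulHom f • x = mulHom f • mulHom (sig k p k) • x
    rw [smul_smul, smul_smul, ← map_mul, ← map_mul, mul_comm]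
  have hz : ∀ j q, zvec p u q j ∈ T := by
    intro j
    induction j using WellFoundedLT.induction with
    | ind j ih =>
      intro q
      have := zvec_triangular hu hk hT (q := q) fun j' hj' => ih j' hj' _
      exact mem_of_const_smul_mem hT (hq q)
        ((add_mem_cancel_left (show mulHom (sig k p k) • _ ∈ T from ⟨_, rfl⟩)).1 this)
  obtain ⟨q, hx⟩ := exists_eq_combo hu hk hμ P
  exact combo_le hT (fun j => hz j q) hx

end Cyclic

/-! ### A solution of the system `L_μ` in the connection module -/

theorem sum_lco_smul_connMat (a : Fin k) :
    ∑ i : Fin k, lco p i • connMat i a = (Pi.single a 1 : Fin k → HolLoc k p) := by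
  have h : ∑ i : Fin k, lco p i • connMat i = (1 : Matrix (Fin k) (Fin k) (HolLoc k p)) := by
    simp only [connMat, ← smul_mul_assoc]
    rw [← Finset.sum_mul, ← matM_eq, Matrix.mul_nonsing_inv _ isUnit_det_matM]
  ext b
  have h1 := congrFun (congrFun h a) b
  rw [Matrix.sum_apply] at h1
  rw [← Matrix.one_eq_pi_single, ← h1, Finset.sum_apply]
  rfl

/-- The connection module contains a solution of the system `L_μ` whose first derivatives are the
standard basis. -/
theorem exists_solution (hk : 1 ≤ k) {μ : ℂ} (hμ : μ ≠ 0) :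
    letI := connModule k p μ
    ∃ v : FreeLoc k p, (∀ P ∈ idealL k p μ, P • v = 0) ∧
      ∀ a, a < k → pd k p (a + 1) • v = stdVec k p (a + 1) := by
  let := connModule k p μ
  obtain ⟨-, -, hsymm, hzero⟩ := isConnectionAction_connModule (p := p) hk μ
  have hcomm : ∀ i j : Fin k, (pdOp i : DiffOp k p) • stdVec k p (j + 1) =
      (pdOp j : DiffOp k p) • stdVec k p (i + 1) := by
    intro i j
    rw [← pd_eq i.2, ← pd_eq j.2]
    by_cases h : (i : ℕ) + j + 2 ≤ k
    · rw [hzero _ _ (by omega) (by omega) (by omega), hzero _ _ (by omega) (by omega) (by omega)]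
    · exact (hsymm _ _ (i + j + 2 - k) (by omega) (by omega) (by omega) (by omega) (by omega)
        (by omega) (by omega)).trans (hsymm _ _ (i + j + 2 - k) (by omega) (by omega) (by omega)
        (by omega) (by omega) (by omega) (by omega)).symm
  -- `E` acts on each `e_a` as `-(μ+1)`, because `∑ σ_{i+1} connMat i = M M⁻¹ = 1`.
  have heuler : ∀ a : Fin k, ∑ i, mulHom (co k p i) • (pdOp i : DiffOp k p) • stdVec k p (a + 1) =
      mulHom (algebraMap ℂ (Hol k p) (-(μ + 1))) • stdVec k p (a + 1) := by
    intro a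
    have h1 : ∀ i : Fin k, mulHom (co k p i) • (pdOp i : DiffOp k p) • stdVec k p (a + 1) =
        (-connConst k p μ • (lco p i • connMat i a) : Fin k → HolLoc k p) := by
      intro i
      rw [connModule_mulHom, connModule_pdOp, conn_stdVec]
      refine (smul_neg (lco p i) (connConst k p μ • connMat i a)).trans ?_
      rw [smul_comm, neg_smul]
    rw [Finset.sum_congr rfl fun i _ => h1 i, connModule_mulHom, map_neg, map_neg]
    refine (Finset.smul_sum (M := HolLoc k p) (N := Fin k → HolLoc k p)).symm.trans ?_
    rw [sum_lco_smul_connMat, ← stdVec_eq]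
    rfl
  -- The equation `(E + μ) v = 0` with `∂_h v = e_h` forces `v = -μ⁻¹ w`. Conversely, `∂_a e_j = ∂_j
  -- e_a` turns `∂_a w` into `e_a + E e_a = -μ e_a`.
  set w : FreeLoc k p := ∑ j : Fin k, mulHom (co k p j) • stdVec k p (j + 1) with hw
  have hpdw : ∀ a : Fin k, (pdOp a : DiffOp k p) • w =
      mulHom (algebraMap ℂ (Hol k p) (-μ)) • stdVec k p (a + 1) := by
    intro a
    have h1 : ∀ j : Fin k, (pdOp a : DiffOp k p) • mulHom (co k p j) • stdVec k p (j + 1) =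
        mulHom (co k p j) • (pdOp j : DiffOp k p) • stdVec k p (a + 1) +
          if a = j then stdVec k p (j + 1) else 0 := by
      intro j
      rw [pdOp_smul_mulHom_smul, hcomm, partialDeriv_co]
      split_ifs <;> simp
    rw [hw, Finset.smul_sum, Finset.sum_congr rfl fun j _ => h1 j, Finset.sum_add_distrib, heuler,
      Finset.sum_ite_eq, if_pos (Finset.mem_univ _), neg_add, map_add, map_add, add_smul,
      map_neg, map_neg _ (1 : ℂ), map_one, map_neg mulHom 1, map_one, neg_one_smul,
      neg_add_cancel_right]
  set v : FreeLoc k p := mulHom (algebraMap ℂ (Hol k p) (-μ⁻¹)) • w with hv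
  have hpdv : ∀ a : Fin k, (pdOp a : DiffOp k p) • v = stdVec k p (a + 1) := by
    intro a
    have h0 : partialDeriv a (algebraMap ℂ (Hol k p) (-μ⁻¹)) = 0 := (pdDer a).map_algebraMap _
    rw [hv, pdOp_smul_mulHom_smul, hpdw, h0, map_zero, zero_smul, add_zero, smul_smul, ← map_mul,
      ← map_mul, neg_mul_neg, inv_mul_cancel₀ hμ, map_one, map_one, one_smul]
  have hpdv' : ∀ a, a < k → pd k p (a + 1) • v = stdVec k p (a + 1) := fun a ha => by
    rw [pd_eq ha]
    exact hpdv ⟨a, ha⟩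
  refine ⟨v, ?_, hpdv'⟩
  have hle : idealL k p μ ≤ LinearMap.ker (LinearMap.toSpanSingleton (DiffOp k p) _ v) := by
    refine Submodule.span_le.2 ?_
    rintro P ((⟨i, j, hi, hik, hj, hjk, rfl⟩ | ⟨m, hm, hmk, rfl⟩) | rfl)
    · obtain ⟨i, rfl⟩ := Nat.exists_eq_add_of_le' hi
      obtain ⟨j, rfl⟩ := Nat.exists_eq_add_of_le' hj
      change (pd k p (i + 1) * pd k p (j + 1 + 1) - pd k p (i + 1 + 1) * pd k p (j + 1)) • v = 0
      rw [sub_smul, mul_smul, mul_smul, hpdv' _ (by omega), hpdv' _ (by omega), sub_eq_zero]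
      by_cases h : i + j + 3 ≤ k
      · rw [hzero _ _ (by omega) (by omega) (by omega),
          hzero _ _ (by omega) (by omega) (by omega)]
      · exact (hsymm _ _ (i + j + 3 - k) (by omega) (by omega) (by omega) (by omega)
          (by omega) (by omega) (by omega)).trans (hsymm _ _ (i + j + 3 - k) (by omega) (by omega)
          (by omega) (by omega) (by omega) (by omega) (by omega)).symm
    · obtain ⟨m, rfl⟩ := Nat.exists_eq_add_of_le' hm
      change (pd k p 1 * pd k p (m + 1)) • v = 0
      rw [mul_smul, hpdv' _ (by omega), hzero _ _ (by omega) (by omega) (by omega)]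
    · change Eop k p μ • v = 0
      rw [Eop_eq, add_smul, Finset.sum_smul]
      simp only [mul_smul, hpdv]
      rw [← hw, hv, smul_smul, ← map_mul, ← map_mul, mul_neg, mul_inv_cancel₀ hμ, map_neg, map_one,
        map_neg, map_one, neg_one_smul, add_neg_cancel]
  exact fun P hP => hle hP

/-! ### The map `ℳ_{μ+1} → ℳ_μ` and its cokernel -/

/-- Right multiplication by `E + μ`, from `ℳ_{μ+1}` to `ℳ_μ`. -/
def mulEop (k : ℕ) (p : Fin k → ℂ) (μ : ℂ) : ModM k p (μ + 1) →ₗ[DiffOp k p] ModM k p μ :=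
  (idealI k p (μ + 1)).liftQ
    (LinearMap.toSpanSingleton (DiffOp k p) (ModM k p μ) (cls μ (Eop k p μ))) <| by
    -- Moving `E + μ` past two derivatives gives `A_{i,j} (E+μ) = (E+μ+2) A_{i,j}` and `T^m_{μ+1}
    -- (E+μ) = (E+μ+2) T^m_μ`.
    have h2 : ∀ a b : ℕ, pd k p a * pd k p b * Eop k p μ =
        Eop k p (μ + 2) * (pd k p a * pd k p b) := fun a b => by
      rw [mul_assoc, pd_mul_Eop, ← mul_assoc, pd_mul_Eop, mul_assoc,
        show μ + 1 + 1 = μ + 2 by ring]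
    refine Submodule.span_le.2 fun P hP => ?_
    change P • cls μ (Eop k p μ) = 0
    rw [cls, ← map_smul, Submodule.mkQ_apply, Submodule.Quotient.mk_eq_zero, smul_eq_mul]
    rcases hP with hP | ⟨m, hm, hmk, rfl⟩
    · have hP' := hP
      obtain ⟨i, j, hi, hik, hj, hjk, rfl⟩ := hP
      rw [sub_mul, h2, h2, ← mul_sub]
      exact Submodule.smul_mem _ _ (Submodule.subset_span (Or.inl hP'))
    · rw [add_mul, h2, pd_mul_Eop (μ + 1), show μ + 1 + 1 = μ + 2 by ring, mul_assoc, ← mul_add]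
      exact Submodule.smul_mem _ _ (Submodule.subset_span (Or.inr ⟨m, hm, hmk, rfl⟩))

theorem mulEop_cls (μ : ℂ) (P : DiffOp k p) :
    mulEop k p μ (cls (μ + 1) P) = cls μ (P * Eop k p μ) := rfl

theorem cls_eq_zero {μ : ℂ} {P : DiffOp k p} : cls μ P = 0 ↔ P ∈ idealI k p μ :=
  Submodule.Quotient.mk_eq_zero _

theorem cls_surjective (μ : ℂ) : Function.Surjective (cls (k := k) (p := p) μ) :=
  Submodule.mkQ_surjective _

theorem mulEop_injective (hk : 1 ≤ k) {μ : ℂ} (hμ : μ ≠ 0) :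
    Function.Injective (mulEop k p μ) := by
  rw [injective_iff_map_eq_zero]
  intro x hx
  obtain ⟨P, rfl⟩ := cls_surjective _ x
  rw [mulEop_cls, cls_eq_zero] at hx
  exact cls_eq_zero.2 (mem_idealI_of_mul_Eop_mem hk hμ hx)

/-- The range is generated by the class of `E + μ`, and modulo left multiples of `E + μ` the
generator `T^{m+1}_μ` becomes `∂_1 ∂_m`. -/
theorem mkQ_cls_eq_zero_iff (μ : ℂ) (P : DiffOp k p) :
    (LinearMap.range (mulEop k p μ)).mkQ (cls μ P) = 0 ↔ P ∈ idealL k p μ := by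
  rw [Submodule.mkQ_apply, Submodule.Quotient.mk_eq_zero]
  constructor
  · rintro ⟨x, hx⟩
    obtain ⟨R, rfl⟩ := cls_surjective _ x
    rw [mulEop_cls, ← sub_eq_zero, cls, cls, ← map_sub] at hx
    have h1 := idealI_le_idealL μ (cls_eq_zero.1 hx)
    have h2 : R * Eop k p μ ∈ idealL k p μ :=
      (idealL k p μ).smul_mem R (Submodule.subset_span (Or.inr rfl))
    simpa using (idealL k p μ).sub_mem h2 h1
  · suffices h : idealL k p μ ≤ (LinearMap.range (mulEop k p μ)).comap (idealI k p μ).mkQ from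
      fun hP => h hP
    have hE : ∀ R : DiffOp k p,
        R * Eop k p μ ∈ (LinearMap.range (mulEop k p μ)).comap (idealI k p μ).mkQ :=
      fun R => ⟨cls _ R, rfl⟩
    have hI : idealI k p μ ≤ (LinearMap.range (mulEop k p μ)).comap (idealI k p μ).mkQ := by
      intro R hR
      rw [Submodule.mem_comap, show (idealI k p μ).mkQ R = 0 from cls_eq_zero.2 hR]
      exact Submodule.zero_mem _
    refine Submodule.span_le.2 ?_
    rintro R ((hR | ⟨m, hm, hmk, rfl⟩) | rfl)
    · exact hI (Submodule.subset_span (Or.inl hR))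
    · have h1 := hI (Submodule.subset_span (Or.inr ⟨m + 1, by omega, by omega, rfl⟩))
      exact (Submodule.add_mem_iff_left _ (hE _)).1 h1
    · simpa using hE 1

theorem mulHom_sig_pow_smul {V : Type*} [AddCommGroup V] [Module (DiffOp k p) V] (n : ℕ) (v : V) :
    mulOp (sig k p k) ^ n • v = mulHom (sig k p k ^ n) • v := by
  rw [map_pow]
  rfl

theorem hol_algebraMap_injective (hk : 1 ≤ k) :
    Function.Injective (algebraMap (Hol k p) (HolLoc k p)) := by
  refine IsLocalization.injective _ (M := Submonoid.powers (sig k p k)) ?_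
  rw [Submonoid.powers_le, mem_nonZeroDivisors_iff_right]
  intro f hf
  rw [← co_last hk, mul_comm] at hf
  exact eq_zero_of_co_mul_eq_zero _ _ hf

/-! ### Comparison of the cyclic module with the connection -/

section Compare

variable {Q : Type*} [AddCommGroup Q] [Module (DiffOp k p) Q] {u : Q} {μ : ℂ}
  (hgen : ∀ x : Q, ∃ P : DiffOp k p, x = P • u) (hu : ∀ P ∈ idealL k p μ, P • u = 0)
  [Module (DiffOp k p) (FreeLoc k p)] (hconn : ∀ (f : Hol k p) (v : FreeLoc k p),
    mulHom f • v = algebraMap (Hol k p) (HolLoc k p) f • v)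
  (φ : Q →ₗ[DiffOp k p] FreeLoc k p)
  (hφ : ∀ a, a < k → φ (pd k p (a + 1) • u) = stdVec k p (a + 1))

include hconn in
theorem map_combo (y : Fin k → Q) (f : Fin k → Hol k p) :
    φ (combo p y f) = ∑ j, algebraMap (Hol k p) (HolLoc k p) (f j) • φ (y j) := by
  simp [combo_apply, hconn]

include hφ in
theorem map_zvec_zero (j : Fin k) : φ (zvec p u 0 j) = stdVec k p (j + 1) := by
  rw [zvec, pow_zero, one_mul, hφ j j.2]

include hconn in
theorem sig_smul_bijective (n : ℕ) :
    Function.Bijective fun v : FreeLoc k p => mulOp (sig k p k) ^ n • v := by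
  obtain ⟨w, hw⟩ := (isUnit_sig (k := k) (p := p)).pow n
  have h : ∀ v : FreeLoc k p, mulOp (sig k p k) ^ n • v = (w : HolLoc k p) • v := fun v => by
    rw [mulHom_sig_pow_smul, hconn, map_pow, hw]
  simp only [h]
  refine Function.bijective_iff_has_inverse.2 ⟨fun v => (w⁻¹ : (HolLoc k p)ˣ).1 • v, ?_, ?_⟩
  · intro v
    simp only [smul_smul, Units.inv_mul, one_smul]
  · intro v
    simp only [smul_smul, Units.mul_inv, one_smul]

include hgen hu hconn hφ

/-- Clearing denominators in coordinates puts a multiple of `v` in the image. For the kernel, a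
power of `σ_k` makes `x` a combination `∑ f_j z_{0,j}`, whose image has coordinates `f_j`; these
vanish because `𝒪` embeds in `𝒪[σ_k⁻¹]`. -/
theorem isSigmaLocalization_of_cyclic (hk : 1 ≤ k) (hμ : μ ≠ 0) :
    IsSigmaLocalization k p φ := by
  refine ⟨by simpa using sig_smul_bijective hconn 1, fun v => ?_, fun x hx => ?_⟩
  · obtain ⟨⟨_, n, rfl⟩, hn⟩ := IsLocalization.exist_integer_multiples_of_finite
      (Submonoid.powers (sig k p k)) (v : Fin k → HolLoc k p)
    choose f hf using hn
    refine ⟨n, combo p (zvec p u 0) f, ?_⟩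
    rw [map_combo hconn, mulHom_sig_pow_smul, hconn]
    simp only [map_zvec_zero φ hφ, hf]
    rw [sum_smul_stdVec fun j => (sig k p k ^ n) • (v : Fin k → HolLoc k p) j]
    funext j
    exact (Algebra.smul_def (sig k p k ^ n) ((v : Fin k → HolLoc k p) j)).symm
  · obtain ⟨P, rfl⟩ := hgen x
    obtain ⟨n, f, hf⟩ := exists_pow_smul_mem_combo hu hk hμ P
    have h1 := congrArg φ hf
    rw [map_smul, hx, smul_zero, map_combo hconn] at h1
    simp only [map_zvec_zero φ hφ] at h1
    rw [sum_smul_stdVec fun j => algebraMap (Hol k p) (HolLoc k p) (f j)] at h1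
    have h2 : f = 0 := funext fun j => hol_algebraMap_injective hk
      ((congrFun h1 j).trans (map_zero _).symm)
    refine ⟨n, ?_⟩
    rw [mulHom_sig_pow_smul, ← hf, h2, map_zero]

/-- An element of `Q` is a combination of the `z_{q,j}` for some `q`, so injectivity follows once
their images are a basis of `V`. Surjectivity combines the localization property with divisibility
by `σ_k` in `Q`. -/
theorem bijective_of_cyclic (hk : 1 ≤ k) (hμ : ∀ n : ℕ, μ ≠ -(n : ℂ)) :
    Function.Bijective φ := by
  have hμ0 : μ ≠ 0 := by simpa using hμ 0
  have hq : ∀ q : ℕ, μ + (q + 1) ≠ 0 := fun q h => hμ (q + 1) (by push_cast; linear_combination h)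
  constructor
  · let F : ℕ → (Fin k → HolLoc k p) →ₗ[HolLoc k p] (Fin k → HolLoc k p) := fun q =>
      Fintype.linearCombination (HolLoc k p) fun j => (φ (zvec p u q j) : Fin k → HolLoc k p)
    have hF : ∀ q, Function.Surjective (F q) := by
      intro q
      induction q with
      | zero =>
        intro v
        refine ⟨v, ?_⟩
        have := sum_smul_stdVec v
        simp only [← map_zvec_zero φ hφ] at this
        exact this
      | succ q ih =>
        rw [← LinearMap.range_eq_top, eq_top_iff, ← LinearMap.range_eq_top.2 ih]
        rintro _ ⟨v, rfl⟩
        change ∑ j, v j • (φ (zvec p u q j) : Fin k → HolLoc k p) ∈ LinearMap.range (F (q + 1))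
        refine Submodule.sum_mem _ fun j _ => Submodule.smul_mem _ _ ?_
        obtain ⟨f, hf⟩ := zvec_mem_combo_succ hu hk (hq q) j
        refine ⟨fun j => algebraMap _ _ (f j), ?_⟩
        have := congrArg φ hf
        rw [map_combo hconn] at this
        exact this
    rw [injective_iff_map_eq_zero]
    intro x hx
    obtain ⟨P, rfl⟩ := hgen x
    obtain ⟨q, f, hf⟩ := exists_eq_combo hu hk hμ P
    rw [← hf, map_combo hconn] at hx
    -- The `k` vectors `φ z_{q,j}` span `V`, which is free of rank `k`, hence are linearly
    -- independent.
    have h1 : (fun j => algebraMap (Hol k p) (HolLoc k p) (f j)) = 0 :=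
      OrzechProperty.injective_of_surjective_endomorphism (F q) (hF q)
        (hx.trans (map_zero (F q)).symm)
    have h2 : f = 0 := funext fun j => hol_algebraMap_injective hk
      ((congrFun h1 j).trans (map_zero _).symm)
    rw [← hf, h2, map_zero]
  · intro v
    obtain ⟨-, hsurj, -⟩ := isSigmaLocalization_of_cyclic hgen hu hconn φ hφ hk hμ0
    obtain ⟨n, x, hx⟩ := hsurj v
    have hdiv : ∀ (n : ℕ) (x : Q), ∃ y : Q, mulOp (sig k p k) ^ n • y = x := by
      intro n
      induction n with
      | zero => exact fun x => ⟨x, by rw [pow_zero, one_smul]⟩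
      | succ n ih =>
        intro x
        obtain ⟨P, rfl⟩ := hgen x
        obtain ⟨y, hy⟩ := exists_sig_smul_eq hu hk hμ P
        obtain ⟨z, rfl⟩ := ih y
        exact ⟨z, by rw [pow_succ', mul_smul]; exact hy⟩
    obtain ⟨y, rfl⟩ := hdiv n x
    refine ⟨y, (sig_smul_bijective hconn n).1 ?_⟩
    simp only
    rw [hx, map_smul]

end Compare

end MuTrace

end

theorem proposition4p1p1 (k : ℕ) (hk : 1 ≤ k) (μ : ℂ) (hμ : μ ≠ 0) (p : Fin k → ℂ) :
    ∃ Φ : MuTrace.ModM k p (μ + 1) →ₗ[MuTrace.DiffOp k p] MuTrace.ModM k p μ,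
      (∀ P : MuTrace.DiffOp k p,
        Φ (MuTrace.cls (μ + 1) P) = MuTrace.cls μ (P * MuTrace.Eop k p μ)) ∧
      Function.Injective Φ ∧
      (∀ P : MuTrace.DiffOp k p,
        (LinearMap.range Φ).mkQ (MuTrace.cls μ P) = 0 ↔ P ∈ MuTrace.idealL k p μ) ∧
      IsUnit (MuTrace.matM k p).det ∧
      (∃ (inst : Module (MuTrace.DiffOp k p) (MuTrace.FreeLoc k p))
        (φ : (MuTrace.ModM k p μ ⧸ LinearMap.range Φ) →ₗ[MuTrace.DiffOp k p]
          MuTrace.FreeLoc k p),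
        MuTrace.IsConnectionAction k p μ inst ∧
        (∀ h : ℕ, 1 ≤ h → h ≤ k →
          φ ((LinearMap.range Φ).mkQ (MuTrace.cls μ (MuTrace.pd k p h))) =
            MuTrace.stdVec k p h) ∧
        MuTrace.IsSigmaLocalization k p φ ∧
        ((∀ n : ℕ, μ ≠ -(n : ℂ)) → Function.Bijective φ)) ∧
      ((∀ n : ℕ, μ ≠ -(n : ℂ)) → ∀ n h : ℕ, 1 ≤ n → 1 ≤ h → h ≤ k →
        ∃! ξ : MuTrace.ModM k p μ ⧸ LinearMap.range Φ,
          MuTrace.mulOp (MuTrace.sig k p k) ^ n • ξ =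
            (LinearMap.range Φ).mkQ (MuTrace.cls μ (MuTrace.pd k p h))) := by
  let inst := MuTrace.connModule k p μ
  obtain ⟨v, hv, hpd⟩ := MuTrace.exists_solution (p := p) hk hμ
  have hconn := MuTrace.connModule_mulHom (k := k) (p := p) μ
  let u : MuTrace.ModM k p μ ⧸ LinearMap.range (MuTrace.mulEop k p μ) :=
    (LinearMap.range (MuTrace.mulEop k p μ)).mkQ (MuTrace.cls μ 1)
  have hPu : ∀ P : MuTrace.DiffOp k p,
      P • u = (LinearMap.range (MuTrace.mulEop k p μ)).mkQ (MuTrace.cls μ P) := by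
    intro P
    rw [← map_smul, MuTrace.cls, MuTrace.cls, ← map_smul, smul_eq_mul, mul_one]
  have hgen : ∀ x, ∃ P : MuTrace.DiffOp k p, x = P • u := by
    intro x
    obtain ⟨y, rfl⟩ := Submodule.mkQ_surjective _ x
    obtain ⟨P, rfl⟩ := MuTrace.cls_surjective _ y
    exact ⟨P, (hPu P).symm⟩
  have hu : ∀ P ∈ MuTrace.idealL k p μ, P • u = 0 := fun P hP => by
    rw [hPu, MuTrace.mkQ_cls_eq_zero_iff]
    exact hP
  let φ : (MuTrace.ModM k p μ ⧸ LinearMap.range (MuTrace.mulEop k p μ)) →ₗ[MuTrace.DiffOp k p]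
      MuTrace.FreeLoc k p :=
    Submodule.liftQ _
      ((MuTrace.idealI k p μ).liftQ (LinearMap.toSpanSingleton (MuTrace.DiffOp k p) _ v)
        fun P hP => hv P (MuTrace.idealI_le_idealL μ hP)) <| by
      rintro _ ⟨x, rfl⟩
      obtain ⟨P, rfl⟩ := MuTrace.cls_surjective _ x
      exact hv _ (Submodule.smul_mem _ P (Submodule.subset_span (Or.inr rfl)))
  have hφP : ∀ P : MuTrace.DiffOp k p,
      φ ((LinearMap.range (MuTrace.mulEop k p μ)).mkQ (MuTrace.cls μ P)) = P • v := fun _ => rfl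
  have hφ : ∀ a, a < k → φ (MuTrace.pd k p (a + 1) • u) = MuTrace.stdVec k p (a + 1) :=
    fun a ha => by rw [hPu, hφP, hpd a ha]
  refine ⟨MuTrace.mulEop k p μ, MuTrace.mulEop_cls μ, MuTrace.mulEop_injective hk hμ,
    MuTrace.mkQ_cls_eq_zero_iff μ, MuTrace.isUnit_det_matM, ⟨inst, φ,
      MuTrace.isConnectionAction_connModule hk μ, fun h h1 h2 => ?_,
      MuTrace.isSigmaLocalization_of_cyclic hgen hu hconn φ hφ hk hμ,
      MuTrace.bijective_of_cyclic hgen hu hconn φ hφ hk⟩, fun hμ' n h _ _ _ => ?_⟩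
  · obtain ⟨h, rfl⟩ := Nat.exists_eq_add_of_le' h1
    rw [hφP, hpd h h2]
  · have hb := MuTrace.bijective_of_cyclic hgen hu hconn φ hφ hk hμ'
    have hs := MuTrace.sig_smul_bijective hconn n
    -- Bijectivity of multiplication by `σ_k^n` is transported from `V` along the isomorphism `φ`.
    have hbij : Function.Bijective fun ξ : MuTrace.ModM k p μ ⧸
        LinearMap.range (MuTrace.mulEop k p μ) => MuTrace.mulOp (MuTrace.sig k p k) ^ n • ξ := by
      rw [← hb.of_comp_iff']
      have : (φ ∘ fun ξ => MuTrace.mulOp (MuTrace.sig k p k) ^ n • ξ) =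
          (fun v => MuTrace.mulOp (MuTrace.sig k p k) ^ n • v) ∘ φ :=
        funext fun ξ => map_smul φ _ ξ
      rw [this]
      exact hs.comp hb
    exact hbij.existsUnique _
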